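/- Let $\alpha>0$ be a real number that is not an even integer. There is an integer $m\ge 0$, depending only on $\alpha$, such that the following holds for every $\xi\in(-1,1)$ and every $g\in C^m([-1,1])$. Put $f(x)=|x-\xi|^{\alpha}g(x)$ for $x\in[-1,1]$, let $P_k$ be the Legendre polynomial of degree $k$ (normalized by $P_k(1)=1$), and let $$\mathcal P_n(x)=\sum_{k=0}^{n}a_k^{L}P_k(x),\qquad a_k^{L}=\frac{2k+1}{2}\int_{-1}^{1}f(t)P_k(t)\,dt,$$ be the Legendre projection of $f$ of degree $n$. Then for every $\epsilon$ with $0<\epsilon<1-|\xi|$ there is a constant $C$, depending only on $\alpha,\xi,g,\epsilon$, such that for all $n\ge 1$ and all $x\in[-1,1]$: - $|f(x)-\mathcal P_n(x)|\le C\,n^{-\alpha}$ if $|x-\xi|<\epsilon$; - $|f(x)-\mathcal P_n(x)|\le C\,n^{-\alpha-1/2}$ if $|x-1|<\epsilon$ or $|x+1|<\epsilon$; - $|f(x)-\mathcal P_n(x)|\le C\,n^{-\alpha-1}$ if $|x-\xi|\ge\epsilon$, $|x-1|\ge\epsilon$ and $|x+1|\ge\epsilon$. -/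

import Mathlib

/-- The Legendre polynomial `P_k`, through Rodrigues' formula
`P_k = (1 / (2 ^ k * k!)) * (d/dx)^k (x ^ 2 - 1) ^ k`. -/
noncomputable def legendrePoly (k : ℕ) : Polynomial ℝ :=
  Polynomial.C (1 / (2 ^ k * (Nat.factorial k : ℝ))) *
    (Polynomial.derivative^[k] ((Polynomial.X ^ 2 - 1) ^ k))

/-- The Legendre coefficient `(2k+1)/2 * ∫_{-1}^{1} f(x) P_k(x) dx`. -/
noncomputable def legendreCoeff (f : ℝ → ℝ) (k : ℕ) : ℝ :=
  (2 * (k : ℝ) + 1) / 2 * ∫ x in (-1 : ℝ)..1, f x * (legendrePoly k).eval x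

/-- The Legendre projection of degree `n` of `f`: the sum of the terms of degree `0, …, n` of its
Legendre series. -/
noncomputable def legendreProj (f : ℝ → ℝ) (n : ℕ) (x : ℝ) : ℝ :=
  ∑ k ∈ Finset.range (n + 1), legendreCoeff f k * (legendrePoly k).eval x

/-- The model function `|x - ξ| ^ α * g(x)` with an algebraic singularity at `ξ`. -/
noncomputable def modelFun (ξ α : ℝ) (g : ℝ → ℝ) (x : ℝ) : ℝ :=
  |x - ξ| ^ α * g x

/-! Everything rests on two size estimates. For interior `x`, Sonin's argument gives `|P_k(x)| =
O(k^(-1/2))`, while `|P_k| ≤ 1` holds up to the endpoints. Integrating by parts against the small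
primitive of `P_k`, until the exponent of `|t - ξ|` lies in `(-1, 0]`, shows that the integral of
`(t - ξ)^j f P_k` is `O(k^(-α-j-3/2))`.

Near `ξ`, the terms `a_k P_k(x)` are therefore `O(k^(-α-1))`, and summing the tail gives `n^(-α)`.
Away from `ξ` absolute summation loses a full power of `n`, and the gain comes from a commutator.
Put `v(t) = (t - ξ)^2 f(t)`. The tail of `v` is `O(n^(-α-3/2))`, even with `|P_k| ≤ 1`. The
projection of `v` at `x`, minus `(x - ξ)^2` times that of `f`, is the projection at `x` of `(t - x)
F(t)` with `F(t) = (t - ξ + x - ξ) f(t)`. Christoffel–Darboux collapses it to two boundary terms of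
size `n * |P_n(x)| * n^(-α-3/2)`. Dividing by `(x - ξ)^2` yields `n^(-α-1/2)` from `|P_n| ≤ 1` and
`n^(-α-1)` from the interior bound.

The tail represents the error only if the series converges to `f(x)`. This is shown at interior
points of differentiability, again by Christoffel–Darboux; the estimates pass to `ξ` and `±1` by
continuity in `x` for fixed `n`. -/

/-! ### Algebraic identities for Legendre polynomials -/

open Polynomial in
theorem iterate_derivative_sq_sub_one_pow (n : ℕ) :
    derivative^[n] ((X ^ 2 - 1 : ℝ[X]) ^ n) = C (2 ^ n * (n.factorial : ℝ)) * legendrePoly n := by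
  have h : (2 ^ n * (n.factorial : ℝ)) ≠ 0 := by positivity
  rw [legendrePoly, ← mul_assoc, ← C_mul, mul_one_div_cancel h, C_1, one_mul]

open Polynomial in
theorem derivative_sq_sub_one_pow_succ (n : ℕ) :
    derivative ((X ^ 2 - 1 : ℝ[X]) ^ (n + 1)) = C (2 * ((n : ℝ) + 1)) * (X * (X ^ 2 - 1) ^ n) := by
  rw [derivative_pow_succ]
  simp only [derivative_sub, derivative_X_pow, derivative_one, C_mul, C_add, C_1, C_ofNat, map_natCast]
  push_cast
  ring

theorem legendrePoly_zero : legendrePoly 0 = 1 := by simp [legendrePoly]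

open Polynomial in
theorem legendrePoly_one : legendrePoly 1 = X := by
  have h : (C 2⁻¹ : ℝ[X]) * C 2 = 1 := by rw [← C_mul]; norm_num
  simp only [C_ofNat] at h
  simp only [legendrePoly, pow_one, Nat.factorial_one, Nat.cast_one, mul_one, one_div,
    Function.iterate_one, derivative_sub, derivative_X_pow, derivative_one, Nat.cast_ofNat, C_ofNat]
  linear_combination X * h

-- The first derivative of `(X^2 - 1)^(n+1)` is a multiple of `X (X^2 - 1)^n`. Since `X` is linear,
-- only two Leibniz terms survive the further `n + 1` derivatives.
open Polynomial in
theorem derivative_legendrePoly_succ (n : ℕ) :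
    derivative (legendrePoly (n + 1)) =
      X * derivative (legendrePoly n) + C ((n : ℝ) + 1) * legendrePoly n := by
  have h0 : (2 ^ (n + 1) * ((n + 1).factorial : ℝ)) ≠ 0 := by positivity
  have h : derivative^[n + 1] (derivative ((X ^ 2 - 1 : ℝ[X]) ^ (n + 1))) =
      derivative (C (2 ^ (n + 1) * ((n + 1).factorial : ℝ)) * legendrePoly (n + 1)) := by
    rw [← iterate_derivative_sq_sub_one_pow, ← Function.iterate_succ_apply,
      ← Function.iterate_succ_apply' (f := derivative)]
  rw [derivative_sq_sub_one_pow_succ, iterate_derivative_C_mul, mul_comm X,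
    iterate_derivative_mul_X, Function.iterate_succ_apply', Nat.add_sub_cancel,
    iterate_derivative_sq_sub_one_pow] at h
  simp only [derivative_C_mul] at h
  have h2 : C (2 ^ (n + 1) * ((n + 1).factorial : ℝ)) ≠ (0 : ℝ[X]) := by simpa using h0
  apply mul_left_cancel₀ h2
  rw [← h, Nat.factorial_succ]
  simp only [nsmul_eq_mul, pow_succ]
  push_cast
  simp only [C_mul, C_add, C_1, C_ofNat, map_natCast]
  ring

-- Replacing `X^2` by `(X^2 - 1) + 1` in the second derivative of `(X^2 - 1)^(n+2)` leaves powers `n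
-- + 1` and `n` of `X^2 - 1`, to which Rodrigues' formula applies again. Together with the previous
-- identity this yields the recurrence and the differential equation by pure algebra.
open Polynomial in
theorem derivative_legendrePoly_add_two (n : ℕ) :
    derivative (legendrePoly (n + 2)) =
      C (2 * (n : ℝ) + 3) * legendrePoly (n + 1) + derivative (legendrePoly n) := by
  have h0 : (2 ^ (n + 2) * ((n + 2).factorial : ℝ)) ≠ 0 := by positivity
  have h : derivative^[n + 1] (derivative (derivative ((X ^ 2 - 1 : ℝ[X]) ^ (n + 2)))) =
      derivative (C (2 ^ (n + 2) * ((n + 2).factorial : ℝ)) * legendrePoly (n + 2)) := by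
    rw [← iterate_derivative_sq_sub_one_pow, ← Function.iterate_succ_apply,
      ← Function.iterate_succ_apply, ← Function.iterate_succ_apply' (f := derivative)]
  have h1 : derivative (derivative ((X ^ 2 - 1 : ℝ[X]) ^ (n + 2))) =
      C (2 * ((n : ℝ) + 2) * (2 * n + 3)) * (X ^ 2 - 1) ^ (n + 1) +
      C (4 * ((n : ℝ) + 2) * (n + 1)) * (X ^ 2 - 1) ^ n := by
    rw [derivative_sq_sub_one_pow_succ, derivative_C_mul, derivative_mul,
      derivative_sq_sub_one_pow_succ]
    push_cast
    simp only [C_mul, C_add, C_1, C_ofNat, map_natCast, derivative_X]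
    ring
  rw [h1, iterate_map_add, iterate_derivative_C_mul, iterate_derivative_C_mul,
    iterate_derivative_sq_sub_one_pow, Function.iterate_succ_apply',
    iterate_derivative_sq_sub_one_pow] at h
  simp only [derivative_C_mul] at h
  have h2 : C (2 ^ (n + 2) * ((n + 2).factorial : ℝ)) ≠ (0 : ℝ[X]) := by simpa using h0
  apply mul_left_cancel₀ h2
  rw [← h, Nat.factorial_succ (n + 1), Nat.factorial_succ n]
  simp only [pow_succ]
  push_cast
  simp only [C_mul, C_add, C_1, C_ofNat, map_natCast]
  ring

open Polynomial in
theorem one_sub_sq_mul_derivative_legendrePoly (n : ℕ) :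
    (1 - X ^ 2) * derivative (legendrePoly (n + 1)) =
      C ((n : ℝ) + 1) * (legendrePoly n - X * legendrePoly (n + 1)) := by
  have h1 := derivative_legendrePoly_succ n
  have h2 := derivative_legendrePoly_succ (n + 1)
  have h3 := derivative_legendrePoly_add_two n
  push_cast at h2
  simp only [C_mul, C_add, C_1, C_ofNat, map_natCast] at *
  linear_combination h1 + X * (h2 - h3)

open Polynomial in
theorem legendrePoly_recurrence (n : ℕ) :
    C ((n : ℝ) + 2) * legendrePoly (n + 2) =
      C (2 * (n : ℝ) + 3) * (X * legendrePoly (n + 1)) - C ((n : ℝ) + 1) * legendrePoly n := by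
  have h1 := one_sub_sq_mul_derivative_legendrePoly n
  have h2 := one_sub_sq_mul_derivative_legendrePoly (n + 1)
  have h3 := derivative_legendrePoly_succ (n + 1)
  -- Eliminating the derivatives produces `X` times the recurrence.
  apply mul_left_cancel₀ (X_ne_zero (R := ℝ))
  push_cast at *
  simp only [C_mul, C_add, C_1, C_ofNat, map_natCast] at *
  linear_combination h2 - X * h1 - (1 - X ^ 2) * h3

open Polynomial in
theorem derivative_one_sub_sq_mul_derivative_legendrePoly (n : ℕ) :
    derivative ((1 - X ^ 2) * derivative (legendrePoly n)) =
      - C ((n : ℝ) * (n + 1)) * legendrePoly n := by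
  rcases n with _ | n
  · simp [legendrePoly_zero]
  rw [one_sub_sq_mul_derivative_legendrePoly]
  have h2 := derivative_legendrePoly_succ (n + 1)
  have h3 := derivative_legendrePoly_add_two n
  push_cast at *
  simp only [derivative_mul, derivative_sub, derivative_X, C_mul, C_add, C_1, C_ofNat, map_natCast,
    derivative_add, derivative_one, derivative_natCast] at *
  linear_combination (↑n + 1) * (h2 - h3)

theorem legendrePoly_eval_recurrence (n : ℕ) (x : ℝ) :
    ((n : ℝ) + 2) * (legendrePoly (n + 2)).eval x =
      (2 * (n : ℝ) + 3) * (x * (legendrePoly (n + 1)).eval x)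
        - ((n : ℝ) + 1) * (legendrePoly n).eval x := by
  simpa using congrArg (Polynomial.eval x) (legendrePoly_recurrence n)

theorem legendrePoly_eval_one (n : ℕ) : (legendrePoly n).eval 1 = 1 := by
  induction n using Nat.twoStepInduction with
  | zero => simp [legendrePoly_zero]
  | one => simp [legendrePoly_one]
  | more n h1 h2 =>
    have := legendrePoly_eval_recurrence n 1
    rw [h1, h2] at this
    have h : (n : ℝ) + 2 ≠ 0 := by positivity
    apply mul_left_cancel₀ h
    linarith

theorem legendrePoly_eval_neg (n : ℕ) (x : ℝ) :
    (legendrePoly n).eval (-x) = (-1) ^ n * (legendrePoly n).eval x := by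
  induction n using Nat.twoStepInduction with
  | zero => simp [legendrePoly_zero]
  | one => simp [legendrePoly_one]
  | more n h1 h2 =>
    have := legendrePoly_eval_recurrence n x
    have h' := legendrePoly_eval_recurrence n (-x)
    rw [h1, h2] at h'
    have h : (n : ℝ) + 2 ≠ 0 := by positivity
    apply mul_left_cancel₀ h
    rw [h']
    linear_combination -(-1) ^ n * this

/-! ### Uniform and weighted bounds for Legendre polynomials and their primitives -/

theorem legendrePoly_eval_zero_sq_le (n : ℕ) :
    ((n : ℝ) + 1) * (legendrePoly n).eval 0 ^ 2 ≤ 1 := by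
  induction n using Nat.twoStepInduction with
  | zero => simp [legendrePoly_zero]
  | one => simp [legendrePoly_one]
  | more n h1 _ =>
    have h := legendrePoly_eval_recurrence n 0
    have hn : (0 : ℝ) < (n : ℝ) + 2 := by positivity
    have h2 : (legendrePoly (n + 2)).eval 0 =
        -(((n : ℝ) + 1) * (legendrePoly n).eval 0) / (n + 2) := by
      field_simp
      linarith
    rw [h2, div_pow, neg_sq]
    push_cast
    rw [mul_div_assoc', div_le_one (by positivity)]
    have : 0 ≤ (n : ℝ) := by positivity
    nlinarith

theorem continuous_legendrePoly_eval (n : ℕ) : Continuous fun t : ℝ => (legendrePoly n).eval t :=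
  (legendrePoly n).continuous

theorem Polynomial.eval_le_eval_zero_of_mul_derivative_nonpos (q : Polynomial ℝ)
    (h : ∀ t, t * q.derivative.eval t ≤ 0) (t : ℝ) : q.eval t ≤ q.eval 0 := by
  rcases le_total 0 t with ht | ht
  · refine antitoneOn_of_deriv_nonpos (convex_Ici (0 : ℝ)) q.continuous.continuousOn
      q.differentiable.differentiableOn (fun s hs => ?_) (Set.self_mem_Ici) ht ht
    rw [interior_Ici, Set.mem_Ioi] at hs
    rw [Polynomial.deriv]
    exact nonpos_of_mul_nonpos_right (h s) hs
  · refine monotoneOn_of_deriv_nonneg (convex_Iic (0 : ℝ)) q.continuous.continuousOn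
      q.differentiable.differentiableOn (fun s hs => ?_) ht (Set.self_mem_Iic) ht
    rw [interior_Iic, Set.mem_Iio] at hs
    rw [Polynomial.deriv]
    nlinarith [h s]

theorem eval_derivative_one_sub_sq_mul_derivative_legendrePoly (n : ℕ) (t : ℝ) :
    HasDerivAt (fun t => (1 - t ^ 2) * (legendrePoly n).derivative.eval t)
      (-((n : ℝ) * (n + 1)) * (legendrePoly n).eval t) t := by
  have h := ((1 - Polynomial.X ^ 2) * Polynomial.derivative (legendrePoly n)).hasDerivAt t
  rw [derivative_one_sub_sq_mul_derivative_legendrePoly] at h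
  simpa using h

-- Sonin's monotonicity: by the differential equation the left side has derivative `-2n(n+1) t
-- P_n(t)^2`, so it is largest at `t = 0`. There it equals `n^2 P_{n-1}(0)^2 + n(n+1) P_n(0)^2`, and
-- each term is at most `n`.
open Polynomial in
theorem legendrePoly_sonin (n : ℕ) (t : ℝ) :
    ((1 - t ^ 2) * (legendrePoly n).derivative.eval t) ^ 2 +
      (n : ℝ) * (n + 1) * ((1 - t ^ 2) * (legendrePoly n).eval t ^ 2) ≤ 2 * n := by
  set q : ℝ[X] := ((1 - X ^ 2) * derivative (legendrePoly n)) ^ 2 +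
    C ((n : ℝ) * (n + 1)) * ((1 - X ^ 2) * legendrePoly n ^ 2) with hq
  have hd : derivative q = - C (2 * ((n : ℝ) * (n + 1))) * (X * legendrePoly n ^ 2) := by
    rw [hq, derivative_add, derivative_C_mul, derivative_pow_succ,
      derivative_one_sub_sq_mul_derivative_legendrePoly]
    simp only [derivative_mul, derivative_sub, derivative_one, derivative_X, derivative_pow,
      C_mul, C_ofNat]
    push_cast
    simp only [C_1, C_ofNat, C_add, map_natCast]
    ring
  have h := Polynomial.eval_le_eval_zero_of_mul_derivative_nonpos q (fun s => by
    rw [hd]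
    have : 0 ≤ (n : ℝ) * (n + 1) * (s ^ 2 * (legendrePoly n).eval s ^ 2) := by positivity
    simp only [eval_mul, eval_neg, eval_C, eval_X, eval_pow]
    linarith) t
  simp only [hq, eval_mul, eval_add, eval_sub, eval_one, eval_pow, eval_X, eval_C] at h
  refine h.trans ?_
  rcases n with _ | n
  · simp [legendrePoly_zero]
  have h1 := congrArg (Polynomial.eval 0) (one_sub_sq_mul_derivative_legendrePoly n)
  simp at h1
  have h2 := legendrePoly_eval_zero_sq_le n
  have h3 := legendrePoly_eval_zero_sq_le (n + 1)
  push_cast at *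
  simp only [ne_eq, OfNat.ofNat_ne_zero, not_false_eq_true, zero_pow, sub_zero, one_mul, h1]
  have : 0 < (n : ℝ) + 1 := by positivity
  nlinarith [mul_le_mul_of_nonneg_left h2 this.le, mul_le_mul_of_nonneg_left h3 this.le]

theorem one_sub_sq_mul_legendrePoly_sq_le (n : ℕ) (t : ℝ) :
    (1 - t ^ 2) * (legendrePoly n).eval t ^ 2 ≤ 2 / ((n : ℝ) + 1) := by
  rcases Nat.eq_zero_or_pos n with rfl | hn
  · simp [legendrePoly_zero]; nlinarith [sq_nonneg t]
  have hn' : (0 : ℝ) < n := by exact_mod_cast hn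
  have h := legendrePoly_sonin n t
  have h2 := sq_nonneg ((1 - t ^ 2) * (legendrePoly n).derivative.eval t)
  rw [le_div_iff₀ (by positivity)]
  refine le_of_mul_le_mul_left ?_ hn'
  linarith

theorem abs_one_sub_sq_mul_derivative_legendrePoly_le (n : ℕ) {t : ℝ}
    (ht : t ∈ Set.Icc (-1 : ℝ) 1) :
    |(1 - t ^ 2) * (legendrePoly n).derivative.eval t| ≤ √(2 * n) := by
  apply Real.abs_le_sqrt
  have h := legendrePoly_sonin n t
  have : 0 ≤ 1 - t ^ 2 := by nlinarith [ht.1, ht.2]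
  have : 0 ≤ (n : ℝ) * (n + 1) * ((1 - t ^ 2) * (legendrePoly n).eval t ^ 2) := by positivity
  linarith

-- Without the extra factor `1 - t^2`, the Sonin function has derivative `2 t P_n'(t)^2`. It
-- increases on `[0, 1]` to its value `n(n+1)` at `1`; parity covers negative `t`.
open Polynomial in
theorem abs_legendrePoly_eval_le_one (n : ℕ) {t : ℝ} (ht : t ∈ Set.Icc (-1 : ℝ) 1) :
    |(legendrePoly n).eval t| ≤ 1 := by
  suffices H : ∀ t ∈ Set.Icc (0 : ℝ) 1, |(legendrePoly n).eval t| ≤ 1 by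
    rcases le_total 0 t with h | h
    · exact H t ⟨h, ht.2⟩
    · have := H (-t) ⟨by linarith, by linarith [ht.1]⟩
      simpa [legendrePoly_eval_neg, abs_mul] using this
  intro t ht
  rcases Nat.eq_zero_or_pos n with rfl | hn
  · simp [legendrePoly_zero]
  have hn' : (0 : ℝ) < n := by exact_mod_cast hn
  set q : ℝ[X] := (1 - X ^ 2) * derivative (legendrePoly n) ^ 2 +
    C ((n : ℝ) * (n + 1)) * legendrePoly n ^ 2 with hq
  have hd : derivative q = 2 * (X * derivative (legendrePoly n) ^ 2) := by
    have h := derivative_one_sub_sq_mul_derivative_legendrePoly n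
    rw [hq]
    simp only [derivative_mul, derivative_sub, derivative_one, derivative_X, derivative_pow,
      derivative_add, derivative_C, C_mul] at h ⊢
    push_cast at *
    simp only [C_1, C_ofNat, C_add, map_natCast] at *
    linear_combination 2 * derivative (legendrePoly n) * h
  have h : q.eval t ≤ q.eval 1 := by
    refine monotoneOn_of_deriv_nonneg (convex_Icc (0 : ℝ) 1) q.continuous.continuousOn
      q.differentiable.differentiableOn (fun s hs => ?_) ht (by simp) ht.2
    rw [interior_Icc] at hs
    rw [Polynomial.deriv, hd]
    have := hs.1.le
    simp only [eval_mul, eval_X, eval_pow, eval_ofNat]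
    positivity
  simp only [hq, eval_mul, eval_add, eval_sub, eval_one, eval_pow, eval_X, eval_C,
    legendrePoly_eval_one] at h
  rw [← sq_le_one_iff_abs_le_one]
  have h1 : 0 ≤ (1 - t ^ 2) * (legendrePoly n).derivative.eval t ^ 2 :=
    mul_nonneg (by nlinarith [ht.1, ht.2]) (sq_nonneg _)
  have h2 : 0 < (n : ℝ) * (n + 1) := by positivity
  refine le_of_mul_le_mul_left ?_ h2
  linarith

theorem abs_legendrePoly_eval_le_of_le (n : ℕ) {t δ : ℝ} (hδ : 0 < δ) (h : δ ≤ 1 - t ^ 2) :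
    |(legendrePoly n).eval t| ≤ √(2 / δ) * ((n : ℝ) + 1) ^ (-(1 / 2) : ℝ) := by
  have hn : (0 : ℝ) < (n : ℝ) + 1 := by positivity
  rw [Real.rpow_neg hn.le, ← Real.sqrt_eq_rpow, ← div_eq_mul_inv, ← Real.sqrt_div' _ hn.le]
  apply Real.abs_le_sqrt
  have h1 := one_sub_sq_mul_legendrePoly_sq_le n t
  rw [div_div, le_div_iff₀ (by positivity)]
  rw [le_div_iff₀ hn] at h1
  have : 0 ≤ (1 - t ^ 2 - δ) * ((legendrePoly n).eval t ^ 2 * ((n : ℝ) + 1)) :=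
    mul_nonneg (by linarith) (by positivity)
  linarith

/-- The antiderivative of the Legendre polynomial `P_n`, `n ≥ 1`, vanishing at `±1`. -/
noncomputable def legendrePrim (n : ℕ) (t : ℝ) : ℝ :=
  -((1 - t ^ 2) * (legendrePoly n).derivative.eval t) / ((n : ℝ) * (n + 1))

theorem hasDerivAt_legendrePrim {n : ℕ} (hn : 1 ≤ n) (t : ℝ) :
    HasDerivAt (legendrePrim n) ((legendrePoly n).eval t) t := by
  have hn' : (0 : ℝ) < n := by exact_mod_cast hn
  have h := (eval_derivative_one_sub_sq_mul_derivative_legendrePoly n t).neg.div_const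
    ((n : ℝ) * (n + 1))
  refine HasDerivAt.congr_deriv (f := legendrePrim n) h ?_
  field_simp

theorem legendrePrim_one (n : ℕ) : legendrePrim n 1 = 0 := by simp [legendrePrim]

theorem legendrePrim_neg_one (n : ℕ) : legendrePrim n (-1) = 0 := by simp [legendrePrim]

theorem continuous_legendrePrim (n : ℕ) : Continuous (legendrePrim n) := by
  unfold legendrePrim
  have := (legendrePoly n).derivative.continuous
  fun_prop

/-- This form turns an integration by parts into a difference of two Legendre integrals with a gain
of `1/(2n+3)`. -/
theorem legendrePrim_succ (n : ℕ) (t : ℝ) :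
    legendrePrim (n + 1) t =
      ((legendrePoly (n + 2)).eval t - (legendrePoly n).eval t) / (2 * n + 3) := by
  have h := congrArg (Polynomial.eval t) (one_sub_sq_mul_derivative_legendrePoly n)
  have h2 := legendrePoly_eval_recurrence n t
  simp at h
  rw [legendrePrim, h]
  push_cast
  field_simp
  linear_combination -h2

theorem abs_legendrePrim_le {n : ℕ} (hn : 1 ≤ n) {t : ℝ} (ht : t ∈ Set.Icc (-1 : ℝ) 1) :
    |legendrePrim n t| ≤ 4 * ((n : ℝ) + 1) ^ (-(3 / 2) : ℝ) := by
  have hn' : (1 : ℝ) ≤ n := by exact_mod_cast hn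
  have h := abs_one_sub_sq_mul_derivative_legendrePoly_le n ht
  have h1 : (0 : ℝ) < (n : ℝ) + 1 := by positivity
  rw [legendrePrim, abs_div, abs_neg, abs_of_pos (by positivity : 0 < (n : ℝ) * (n + 1)),
    div_le_iff₀ (by positivity)]
  refine h.trans ?_
  have e : ((n : ℝ) + 1) ^ (-(3 / 2) : ℝ) * ((n : ℝ) + 1) = (√((n : ℝ) + 1))⁻¹ := by
    rw [← Real.rpow_add_one h1.ne', Real.sqrt_eq_rpow, ← Real.rpow_neg h1.le]
    norm_num
  have hs := Real.sq_sqrt h1.le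
  have hs0 := Real.sqrt_pos.mpr h1
  calc √(2 * n) ≤ √(4 * ((n : ℝ) + 1)) := Real.sqrt_le_sqrt (by linarith)
    _ = 2 * √((n : ℝ) + 1) := by
        rw [Real.sqrt_mul (by norm_num), show (4 : ℝ) = 2 ^ 2 by norm_num,
          Real.sqrt_sq (by norm_num)]
    _ ≤ 4 * n * (√((n : ℝ) + 1))⁻¹ := by
        rw [← div_eq_mul_inv, le_div_iff₀ hs0]
        nlinarith
    _ = _ := by rw [← e]; ring

/-! ### Decay of integrals of `P_n` against algebraic singularities -/

theorem exists_bound_of_bound_pos {a : ℕ → ℝ} {C p : ℝ}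
    (h : ∀ n : ℕ, 1 ≤ n → |a n| ≤ C * ((n : ℝ) + 1) ^ p) :
    ∃ C, ∀ n : ℕ, |a n| ≤ C * ((n : ℝ) + 1) ^ p := by
  refine ⟨max C |a 0|, fun n => ?_⟩
  rcases Nat.eq_zero_or_pos n with rfl | hn
  · simp
  · exact (h n hn).trans (by gcongr; exact le_max_left _ _)

theorem intervalIntegrable_sub_rpow {β : ℝ} (hβ : -1 < β) (ξ a b : ℝ) :
    IntervalIntegrable (fun t => (t - ξ) ^ β) MeasureTheory.volume a b := by
  have := (intervalIntegral.intervalIntegrable_rpow' (a := a - ξ) (b := b - ξ) hβ).comp_sub_right ξ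
  simpa using this

theorem hasDerivAt_sub_rpow (β ξ : ℝ) {t : ℝ} (ht : ξ < t) :
    HasDerivAt (fun t => (t - ξ) ^ β) (β * (t - ξ) ^ (β - 1)) t := by
  have h := ((hasDerivAt_id t).sub_const ξ).rpow_const (p := β) (Or.inl (sub_pos.mpr ht).ne')
  simpa [mul_comm] using h

theorem integral_sub_rpow {β : ℝ} (hβ : -1 < β) (ξ c : ℝ) :
    ∫ t in ξ..c, (t - ξ) ^ β = (c - ξ) ^ (β + 1) / (β + 1) := by
  rw [intervalIntegral.integral_comp_sub_right (fun t => t ^ β) ξ, integral_rpow (Or.inl hβ),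
    sub_self, Real.zero_rpow (by linarith), sub_zero]

theorem hasDerivAt_of_contDiffOn_Icc {m : ℕ} {G : ℝ → ℝ} {a b t : ℝ}
    (hG : ContDiffOn ℝ (m + 1 : ℕ) G (Set.Icc a b)) (ht : t ∈ Set.Ioo a b) :
    HasDerivAt G (derivWithin G (Set.Icc a b) t) t := by
  have h1 : DifferentiableWithinAt ℝ G (Set.Icc a b) t :=
    hG.differentiableOn (by simp) t ⟨ht.1.le, ht.2.le⟩
  exact h1.hasDerivWithinAt.hasDerivAt (Icc_mem_nhds ht.1 ht.2)

theorem exists_abs_le_of_continuousOn_Icc {G : ℝ → ℝ} {a b : ℝ}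
    (hG : ContinuousOn G (Set.Icc a b)) : ∃ M, 0 ≤ M ∧ ∀ t ∈ Set.Icc a b, |G t| ≤ M := by
  obtain ⟨M, hM⟩ := isCompact_Icc.exists_bound_of_continuousOn hG
  exact ⟨max M 0, le_max_right _ _, fun t ht => (hM t ht).trans (le_max_left _ _)⟩

/-- The interval is cut at distance of order `1/n` from `ξ`. On the short piece, `|P_n| =
O(n^(-1/2))` and the singularity integrates to `n^(-β-1)`. On the rest, integration by parts against
the primitive of size `n^(-3/2)` costs at most `(c - ξ)^β`, of order `n^(-β)`. -/
theorem exists_bound_integral_legendrePoly_mul_rpow_of_nonpos {ξ : ℝ} (hξ : ξ ∈ Set.Ioo (-1 : ℝ) 1)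
    {β : ℝ} (hβ : -1 < β) (hβ0 : β ≤ 0) {G : ℝ → ℝ}
    (hG : ContDiffOn ℝ (1 : ℕ) G (Set.Icc ξ 1)) :
    ∃ C, ∀ n : ℕ, |∫ t in ξ..1, (legendrePoly n).eval t * ((t - ξ) ^ β * G t)| ≤
      C * ((n : ℝ) + 1) ^ (-β - 3 / 2) := by
  obtain ⟨M, hM0, hM⟩ := exists_abs_le_of_continuousOn_Icc hG.continuousOn
  have hG'c : ContinuousOn (derivWithin G (Set.Icc ξ 1)) (Set.Icc ξ 1) :=
    hG.continuousOn_derivWithin (uniqueDiffOn_Icc hξ.2) (by simp)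
  obtain ⟨M', hM'0, hM'⟩ := exists_abs_le_of_continuousOn_Icc hG'c
  set G' := derivWithin G (Set.Icc ξ 1) with hG'
  set r := 1 - ξ with hr
  have hr0 : 0 < r := sub_pos.mpr hξ.2
  have hβ1 : 0 < β + 1 := by linarith
  -- A lower bound for `1 - t^2` from `ξ` to the midpoint of `[ξ, 1]`; the cut `c` stays below that
  -- midpoint because `n ≥ 1`.
  set δ := 1 - max (ξ ^ 2) (((1 + ξ) / 2) ^ 2) with hδ
  have hδ0 : 0 < δ := by
    rw [hδ, sub_pos, max_lt_iff]
    constructor <;> nlinarith [hξ.1, hξ.2]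
  set K := √(2 / δ) with hK
  refine exists_bound_of_bound_pos (C := K * M * (r ^ (β + 1) / (β + 1)) + 8 * M * r ^ β +
    4 * (M' * (r ^ (β + 1) / (β + 1)))) fun n hn => ?_
  have hn1 : (1 : ℝ) ≤ n := by exact_mod_cast hn
  have hn0 : (0 : ℝ) < (n : ℝ) + 1 := by positivity
  set c := ξ + r / ((n : ℝ) + 1) with hc
  have hcξ : c - ξ = r / ((n : ℝ) + 1) := by rw [hc]; ring
  have hξc : ξ < c := by rw [← sub_pos, hcξ]; positivity
  have hcm : c ≤ (1 + ξ) / 2 := by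
    have : r / ((n : ℝ) + 1) ≤ r / 2 := by gcongr; linarith
    rw [hc]; linarith
  have hc1 : c < 1 := by linarith [hξ.2]
  have hu (a b : ℝ) (h1 : ξ ≤ a) (h2 : a ≤ b) (h3 : b ≤ 1) :
      IntervalIntegrable (fun t => (legendrePoly n).eval t * ((t - ξ) ^ β * G t))
        MeasureTheory.volume a b := by
    refine ((intervalIntegrable_sub_rpow hβ ξ a b).mul_continuousOn ?_).continuousOn_mul
      (continuous_legendrePoly_eval n).continuousOn
    rw [Set.uIcc_of_le h2]
    exact hG.continuousOn.mono (Set.Icc_subset_Icc h1 h3)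
  have hinner : |∫ t in ξ..c, (legendrePoly n).eval t * ((t - ξ) ^ β * G t)| ≤
      K * ((n : ℝ) + 1) ^ (-(1 / 2) : ℝ) * M * ((c - ξ) ^ (β + 1) / (β + 1)) := by
    rw [← integral_sub_rpow hβ, ← intervalIntegral.integral_const_mul, ← Real.norm_eq_abs]
    refine intervalIntegral.norm_integral_le_of_norm_le hξc.le (.of_forall fun t ht => ?_)
      ((intervalIntegrable_sub_rpow hβ ξ ξ c).const_mul _)
    have h1 : 0 < t - ξ := sub_pos.mpr ht.1
    have h2 := hM t ⟨ht.1.le, ht.2.trans hc1.le⟩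
    have h3 : |(legendrePoly n).eval t| ≤ K * ((n : ℝ) + 1) ^ (-(1 / 2) : ℝ) := by
      refine abs_legendrePoly_eval_le_of_le n hδ0 ?_
      have : t ^ 2 ≤ max (ξ ^ 2) (((1 + ξ) / 2) ^ 2) := by
        rcases le_total 0 t with h | h
        · exact le_max_of_le_right (by nlinarith [ht.2])
        · exact le_max_of_le_left (by nlinarith [ht.1])
      linarith
    rw [Real.norm_eq_abs, abs_mul, abs_mul, abs_of_pos (Real.rpow_pos_of_pos h1 β)]
    have := Real.rpow_nonneg h1.le β
    calc _ ≤ (K * ((n : ℝ) + 1) ^ (-(1 / 2) : ℝ)) * ((t - ξ) ^ β * M) := by gcongr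
      _ = _ := by ring
  have hQ (t : ℝ) (h1 : ξ ≤ t) (h2 : t ≤ 1) :
      |legendrePrim n t| ≤ 4 * ((n : ℝ) + 1) ^ (-(3 / 2) : ℝ) :=
    abs_legendrePrim_le hn ⟨by linarith [hξ.1], h2⟩
  have hu' : IntervalIntegrable (fun t => β * (t - ξ) ^ (β - 1) * G t + (t - ξ) ^ β * G' t)
      MeasureTheory.volume c 1 := by
    apply ContinuousOn.intervalIntegrable
    rw [Set.uIcc_of_le hc1.le]
    have hs : Set.Icc c 1 ⊆ Set.Icc ξ 1 := Set.Icc_subset_Icc_left hξc.le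
    have hp (p : ℝ) : ContinuousOn (fun t => (t - ξ) ^ p) (Set.Icc c 1) := fun t ht =>
      (hasDerivAt_sub_rpow p ξ (hξc.trans_le ht.1)).continuousAt.continuousWithinAt
    exact ((continuousOn_const.mul (hp _)).mul (hG.continuousOn.mono hs)).add
      ((hp _).mul (hG'c.mono hs))
  have hparts := intervalIntegral.integral_mul_deriv_eq_deriv_mul_of_hasDerivAt
    (u := fun t => (t - ξ) ^ β * G t) (v := legendrePrim n)
    (u' := fun t => β * (t - ξ) ^ (β - 1) * G t + (t - ξ) ^ β * G' t)
    (v' := fun t => (legendrePoly n).eval t) (a := c) (b := 1) ?_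
    (continuous_legendrePrim n).continuousOn ?_ (fun t _ => hasDerivAt_legendrePrim hn t) hu'
    ((continuous_legendrePoly_eval n).intervalIntegrable _ _)
  rotate_left
  · rw [Set.uIcc_of_le hc1.le]
    exact ContinuousOn.mul (fun t ht =>
      (hasDerivAt_sub_rpow β ξ (hξc.trans_le ht.1)).continuousAt.continuousWithinAt)
      (hG.continuousOn.mono (Set.Icc_subset_Icc_left hξc.le))
  · rw [min_eq_left hc1.le, max_eq_right hc1.le]
    intro t ht
    exact (hasDerivAt_sub_rpow β ξ (hξc.trans ht.1)).mul
      (hasDerivAt_of_contDiffOn_Icc (m := 0) hG ⟨hξc.trans ht.1, ht.2⟩)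
  have hrem : |∫ t in c..1, (β * (t - ξ) ^ (β - 1) * G t + (t - ξ) ^ β * G' t) *
      legendrePrim n t| ≤ 4 * ((n : ℝ) + 1) ^ (-(3 / 2) : ℝ) *
        (M * (c - ξ) ^ β + M' * (r ^ (β + 1) / (β + 1))) := by
    -- Since `β ≤ 0`, `|β| (t - ξ)^(β-1)` is the derivative of `-(t - ξ)^β`, so the majorant has an
    -- explicit primitive.
    have hΦ (t : ℝ) (ht : t ∈ Set.uIcc c 1) : HasDerivAt
        (fun t => -M * (t - ξ) ^ β + M' * ((t - ξ) ^ (β + 1) / (β + 1)))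
        (-β * M * (t - ξ) ^ (β - 1) + M' * (t - ξ) ^ β) t := by
      rw [Set.uIcc_of_le hc1.le] at ht
      have h1 := (hasDerivAt_sub_rpow β ξ (hξc.trans_le ht.1)).const_mul (-M)
      have h2 := ((hasDerivAt_sub_rpow (β + 1) ξ (hξc.trans_le ht.1)).div_const (β + 1)).const_mul M'
      refine (h1.add h2).congr_deriv ?_
      rw [add_sub_cancel_right]
      field_simp
    have hI : IntervalIntegrable (fun t => -β * M * (t - ξ) ^ (β - 1) + M' * (t - ξ) ^ β)
        MeasureTheory.volume c 1 := by
      apply ContinuousOn.intervalIntegrable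
      rw [Set.uIcc_of_le hc1.le]
      have hp (p : ℝ) : ContinuousOn (fun t => (t - ξ) ^ p) (Set.Icc c 1) := fun t ht =>
        (hasDerivAt_sub_rpow p ξ (hξc.trans_le ht.1)).continuousAt.continuousWithinAt
      exact (continuousOn_const.mul (hp _)).add (continuousOn_const.mul (hp _))
    have h1 : |∫ t in c..1, (β * (t - ξ) ^ (β - 1) * G t + (t - ξ) ^ β * G' t) *
        legendrePrim n t| ≤ ∫ t in c..1, 4 * ((n : ℝ) + 1) ^ (-(3 / 2) : ℝ) *
        (-β * M * (t - ξ) ^ (β - 1) + M' * (t - ξ) ^ β) := by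
      rw [← Real.norm_eq_abs]
      refine intervalIntegral.norm_integral_le_of_norm_le hc1.le (.of_forall fun t ht => ?_)
        (hI.const_mul _)
      have h1 : 0 < t - ξ := sub_pos.mpr (hξc.trans ht.1)
      have h2 := hM t ⟨(hξc.trans ht.1).le, ht.2⟩
      have h3 := hM' t ⟨(hξc.trans ht.1).le, ht.2⟩
      have h4 := Real.rpow_pos_of_pos h1 (β - 1)
      have h5 := Real.rpow_pos_of_pos h1 β
      have h6 : |β * (t - ξ) ^ (β - 1) * G t + (t - ξ) ^ β * G' t| ≤
          -β * M * (t - ξ) ^ (β - 1) + M' * (t - ξ) ^ β := by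
        refine (abs_add_le _ _).trans ?_
        rw [abs_mul, abs_mul, abs_mul, abs_of_pos h4, abs_of_pos h5, abs_of_nonpos hβ0]
        have : 0 ≤ -β := by linarith
        calc _ ≤ -β * (t - ξ) ^ (β - 1) * M + (t - ξ) ^ β * M' := by gcongr
          _ = _ := by ring
      rw [Real.norm_eq_abs, abs_mul, mul_comm]
      exact mul_le_mul (hQ t (hξc.trans ht.1).le ht.2) h6 (abs_nonneg _) (by positivity)
    refine h1.trans ?_
    rw [intervalIntegral.integral_const_mul, intervalIntegral.integral_eq_sub_of_hasDerivAt hΦ hI]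
    have h2 : 0 ≤ M * (1 - ξ) ^ β := mul_nonneg hM0 (Real.rpow_nonneg hr0.le _)
    have h3 : 0 ≤ M' * ((c - ξ) ^ (β + 1) / (β + 1)) := by
      have : 0 < c - ξ := sub_pos.mpr hξc
      positivity
    gcongr
    rw [← hr] at *
    linarith
  have hb : |(c - ξ) ^ β * G c * legendrePrim n c| ≤
      (c - ξ) ^ β * M * (4 * ((n : ℝ) + 1) ^ (-(3 / 2) : ℝ)) := by
    have h1 : 0 < (c - ξ) ^ β := Real.rpow_pos_of_pos (sub_pos.mpr hξc) β
    rw [abs_mul, abs_mul, abs_of_pos h1]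
    gcongr
    · exact hM c ⟨hξc.le, hc1.le⟩
    · exact hQ c hξc.le hc1.le
  have hsplit : ∫ t in ξ..1, (legendrePoly n).eval t * ((t - ξ) ^ β * G t) =
      (∫ t in ξ..c, (legendrePoly n).eval t * ((t - ξ) ^ β * G t)) +
      (-((c - ξ) ^ β * G c * legendrePrim n c) -
        ∫ t in c..1, (β * (t - ξ) ^ (β - 1) * G t + (t - ξ) ^ β * G' t) * legendrePrim n t) := by
    rw [← intervalIntegral.integral_add_adjacent_intervals (hu ξ c le_rfl hξc.le hc1.le)
      (hu c 1 hξc.le hc1.le le_rfl)]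
    congr 1
    rw [legendrePrim_one, mul_zero, zero_sub] at hparts
    rw [← hparts]
    exact intervalIntegral.integral_congr fun t _ => mul_comm _ _
  have e1 : ((n : ℝ) + 1) ^ (-(1 / 2) : ℝ) * (c - ξ) ^ (β + 1) =
      r ^ (β + 1) * ((n : ℝ) + 1) ^ (-β - 3 / 2) := by
    rw [hcξ, Real.div_rpow hr0.le hn0.le, div_eq_mul_inv (r ^ _), ← Real.rpow_neg hn0.le, mul_left_comm,
      ← Real.rpow_add hn0]
    congr 2; ring
  have e2 : ((n : ℝ) + 1) ^ (-(3 / 2) : ℝ) * (c - ξ) ^ β =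
      r ^ β * ((n : ℝ) + 1) ^ (-β - 3 / 2) := by
    rw [hcξ, Real.div_rpow hr0.le hn0.le, div_eq_mul_inv (r ^ _), ← Real.rpow_neg hn0.le, mul_left_comm,
      ← Real.rpow_add hn0]
    congr 2; ring
  have e3 : ((n : ℝ) + 1) ^ (-(3 / 2) : ℝ) ≤ ((n : ℝ) + 1) ^ (-β - 3 / 2) :=
    Real.rpow_le_rpow_of_exponent_le (by linarith) (by linarith)
  rw [hsplit]
  refine (abs_add_le _ _).trans ?_
  have h1 := abs_sub (-((c - ξ) ^ β * G c * legendrePrim n c))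
    (∫ t in c..1, (β * (t - ξ) ^ (β - 1) * G t + (t - ξ) ^ β * G' t) * legendrePrim n t)
  rw [abs_neg] at h1
  have h4 : 0 ≤ 4 * (M' * (r ^ (β + 1) / (β + 1))) := by positivity
  calc _ ≤ K * ((n : ℝ) + 1) ^ (-(1 / 2) : ℝ) * M * ((c - ξ) ^ (β + 1) / (β + 1)) +
      ((c - ξ) ^ β * M * (4 * ((n : ℝ) + 1) ^ (-(3 / 2) : ℝ)) +
        4 * ((n : ℝ) + 1) ^ (-(3 / 2) : ℝ) *
        (M * (c - ξ) ^ β + M' * (r ^ (β + 1) / (β + 1)))) := by linarith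
    _ = K * M / (β + 1) * (((n : ℝ) + 1) ^ (-(1 / 2) : ℝ) * (c - ξ) ^ (β + 1)) +
        8 * M * (((n : ℝ) + 1) ^ (-(3 / 2) : ℝ) * (c - ξ) ^ β) +
        4 * (M' * (r ^ (β + 1) / (β + 1))) * ((n : ℝ) + 1) ^ (-(3 / 2) : ℝ) := by ring
    _ ≤ K * M / (β + 1) * (r ^ (β + 1) * ((n : ℝ) + 1) ^ (-β - 3 / 2)) +
        8 * M * (r ^ β * ((n : ℝ) + 1) ^ (-β - 3 / 2)) +
        4 * (M' * (r ^ (β + 1) / (β + 1))) * ((n : ℝ) + 1) ^ (-β - 3 / 2) := by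
      rw [e1, e2]; gcongr
    _ = _ := by ring

/-- Each integration by parts lowers `β` by one and gains a factor `1/n`. The boundary terms vanish,
at `1` through the primitive and at `ξ` because `β > 0`. One derivative of `G` is spent per step. -/
theorem exists_bound_integral_legendrePoly_mul_rpow (k : ℕ) {ξ : ℝ}
    (hξ : ξ ∈ Set.Ioo (-1 : ℝ) 1) {β : ℝ} (hβ : (k : ℝ) - 1 < β) (hβk : β ≤ k) {G : ℝ → ℝ}
    (hG : ContDiffOn ℝ (k + 1 : ℕ) G (Set.Icc ξ 1)) :
    ∃ C, ∀ n : ℕ, |∫ t in ξ..1, (legendrePoly n).eval t * ((t - ξ) ^ β * G t)| ≤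
      C * ((n : ℝ) + 1) ^ (-β - 3 / 2) := by
  induction k generalizing β G with
  | zero =>
    exact exists_bound_integral_legendrePoly_mul_rpow_of_nonpos hξ (by simpa using hβ)
      (by simpa using hβk) hG
  | succ k ih =>
    push_cast at hβ hβk
    have hk : (0 : ℝ) ≤ k := by positivity
    have hβ0 : 0 < β := by linarith
    set G' := derivWithin G (Set.Icc ξ 1) with hG'
    have hG'd : ContDiffOn ℝ (k + 1 : ℕ) G' (Set.Icc ξ 1) :=
      hG.derivWithin (uniqueDiffOn_Icc hξ.2) (by norm_cast)
    -- The derivative of `(t - ξ)^β G` is `(t - ξ)^(β-1) W`, the same shape with exponent `β - 1`.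
    set W : ℝ → ℝ := fun t => β * G t + (t - ξ) * G' t with hW
    have hWd : ContDiffOn ℝ (k + 1 : ℕ) W (Set.Icc ξ 1) :=
      (contDiffOn_const.mul (hG.of_le (by norm_cast; omega))).add
        ((contDiffOn_id.sub contDiffOn_const).mul hG'd)
    obtain ⟨C, hC⟩ := ih (β := β - 1) (G := W) (by linarith) (by linarith) hWd
    have hI (j : ℕ) : IntervalIntegrable (fun t => (legendrePoly j).eval t *
        ((t - ξ) ^ (β - 1) * W t)) MeasureTheory.volume ξ 1 := by
      refine ((intervalIntegrable_sub_rpow (by linarith) ξ ξ 1).mul_continuousOn ?_).continuousOn_mul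
        (continuous_legendrePoly_eval j).continuousOn
      rw [Set.uIcc_of_le hξ.2.le]
      exact hWd.continuousOn
    refine exists_bound_of_bound_pos (C := 2 * (C * 2 ^ (β + 1 / 2))) fun n hn => ?_
    obtain ⟨j, rfl⟩ : ∃ j, n = j + 1 := ⟨n - 1, by omega⟩
    have hparts := intervalIntegral.integral_mul_deriv_eq_deriv_mul_of_hasDerivAt
      (u := fun t => (t - ξ) ^ β * G t) (v := legendrePrim (j + 1))
      (u' := fun t => (t - ξ) ^ (β - 1) * W t)
      (v' := fun t => (legendrePoly (j + 1)).eval t) (a := ξ) (b := 1) ?_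
      (continuous_legendrePrim _).continuousOn ?_ (fun t _ => hasDerivAt_legendrePrim hn t) ?_
      ((continuous_legendrePoly_eval _).intervalIntegrable _ _)
    rotate_left
    · rw [Set.uIcc_of_le hξ.2.le]
      refine ContinuousOn.mul (Continuous.continuousOn ?_) hG.continuousOn
      exact (continuous_id.sub continuous_const).rpow_const fun _ => Or.inr hβ0.le
    · rw [min_eq_left hξ.2.le, max_eq_right hξ.2.le]
      intro t ht
      refine ((hasDerivAt_sub_rpow β ξ ht.1).mul
        (hasDerivAt_of_contDiffOn_Icc hG ht)).congr_deriv ?_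
      have : (t - ξ) ^ β = (t - ξ) ^ (β - 1) * (t - ξ) := by
        rw [← Real.rpow_add_one (sub_pos.mpr ht.1).ne', sub_add_cancel]
      rw [this, hW, hG']
      ring
    · have := hI 0
      simpa [legendrePoly_zero] using this
    have hs : ∫ t in ξ..1, (legendrePoly (j + 1)).eval t * ((t - ξ) ^ β * G t) =
        ((∫ t in ξ..1, (legendrePoly j).eval t * ((t - ξ) ^ (β - 1) * W t)) -
        ∫ t in ξ..1, (legendrePoly (j + 2)).eval t * ((t - ξ) ^ (β - 1) * W t)) / (2 * j + 3) := by
      rw [legendrePrim_one, sub_self, Real.zero_rpow hβ0.ne'] at hparts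
      simp only [zero_mul, mul_zero, sub_zero, zero_sub] at hparts
      rw [← intervalIntegral.integral_sub (hI j) (hI (j + 2)), ← intervalIntegral.integral_div]
      simp only [mul_comm (Polynomial.eval _ (legendrePoly (j + 1)))]
      rw [hparts, ← intervalIntegral.integral_neg]
      refine intervalIntegral.integral_congr fun t _ => ?_
      simp only [legendrePrim_succ]
      ring
    rw [hs, abs_div, abs_of_pos (by positivity : (0 : ℝ) < 2 * j + 3), div_le_iff₀ (by positivity)]
    have hC0 : 0 ≤ C := by simpa using (abs_nonneg _).trans (hC 0)
    have hj : (0 : ℝ) < (j : ℝ) + 2 := by positivity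
    have hj1 : (0 : ℝ) < (j : ℝ) + 1 := by positivity
    -- The neighbouring indices `j` and `j + 2` are both compared with `j + 1`, at the cost of
    -- `2^(β+1/2)`.
    have hpow {y : ℝ} (hy : ((j : ℝ) + 2) / 2 ≤ y) :
        y ^ (-(β - 1) - 3 / 2) ≤ 2 ^ (β + 1 / 2) * ((j : ℝ) + 2) ^ (-(β - 1) - 3 / 2) := by
      calc y ^ (-(β - 1) - 3 / 2) ≤ (((j : ℝ) + 2) / 2) ^ (-(β - 1) - 3 / 2) :=
            Real.rpow_le_rpow_of_nonpos (by positivity) hy (by linarith)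
        _ = _ := by
            rw [Real.div_rpow hj.le (by norm_num), div_eq_mul_inv, ← Real.rpow_neg (by norm_num),
              mul_comm]
            congr 2; ring
    have h1 := hC j
    have h2 := hC (j + 2)
    push_cast at h2
    have h3 := hpow (y := (j : ℝ) + 1) (by linarith)
    have h4 := hpow (y := (j : ℝ) + 2 + 1) (by linarith)
    have e : ((j : ℝ) + 2) ^ (-(β - 1) - 3 / 2) = ((j : ℝ) + 2) ^ (-β - 3 / 2) * (j + 2) := by
      rw [← Real.rpow_add_one hj.ne']; congr 1; ring
    have e' : (((j + 1 : ℕ) : ℝ) + 1) = (j : ℝ) + 2 := by push_cast; ring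
    rw [e']
    have h5 : 0 ≤ C * 2 ^ (β + 1 / 2) * ((j : ℝ) + 2) ^ (-β - 3 / 2) := by positivity
    refine (abs_sub _ _).trans ?_
    rw [e] at h3 h4
    have h3' := mul_le_mul_of_nonneg_left h3 hC0
    have h4' := mul_le_mul_of_nonneg_left h4 hC0
    have h6 := mul_nonneg h5 hj1.le
    linarith

/-- Splitting at `ξ` leaves a one-sided power `α + j` on each half; the reflection `t ↦ -t` and the
parity of `P_n` bring the left half to the right. -/
theorem exists_bound_integral_sub_pow_mul_modelFun_mul_legendrePoly {k : ℕ} {ξ : ℝ}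
    (hξ : ξ ∈ Set.Ioo (-1 : ℝ) 1) {α : ℝ} (hα : 0 < α) {j : ℕ} (hk : α + j ≤ k) {g : ℝ → ℝ}
    (hg : ContDiffOn ℝ (k + 1 : ℕ) g (Set.Icc (-1) 1)) :
    ∃ C, ∀ n : ℕ, |∫ t in (-1 : ℝ)..1, (t - ξ) ^ j * modelFun ξ α g t * (legendrePoly n).eval t| ≤
      C * ((n : ℝ) + 1) ^ (-(α + j) - 3 / 2) := by
  have hβ : 0 < α + j := by positivity
  have hceil : ⌈α + j⌉₊ ≤ k := Nat.ceil_le.mpr hk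
  have h1 : ((⌈α + j⌉₊ : ℕ) : ℝ) - 1 < α + j := by
    linarith [Nat.ceil_lt_add_one hβ.le]
  have hgR : ContDiffOn ℝ (⌈α + j⌉₊ + 1 : ℕ) g (Set.Icc ξ 1) :=
    (hg.mono (Set.Icc_subset_Icc_left hξ.1.le)).of_le (by exact_mod_cast Nat.succ_le_succ hceil)
  have hgL : ContDiffOn ℝ (⌈α + j⌉₊ + 1 : ℕ) (fun t => g (-t)) (Set.Icc (-ξ) 1) := by
    refine ContDiffOn.comp (g := g) (t := Set.Icc (-1) 1)
      (hg.of_le (by exact_mod_cast Nat.succ_le_succ hceil)) contDiff_neg.contDiffOn ?_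
    intro t ht
    exact ⟨by linarith [ht.2], by linarith [ht.1, hξ.2]⟩
  obtain ⟨C₁, hC₁⟩ := exists_bound_integral_legendrePoly_mul_rpow _ hξ h1 (Nat.le_ceil _) hgR
  obtain ⟨C₂, hC₂⟩ := exists_bound_integral_legendrePoly_mul_rpow _ (ξ := -ξ)
    ⟨by linarith [hξ.2], by linarith [hξ.1]⟩ h1 (Nat.le_ceil _) hgL
  refine ⟨C₁ + C₂, fun n => ?_⟩
  have hcont : ContinuousOn
      (fun t => (t - ξ) ^ j * modelFun ξ α g t * (legendrePoly n).eval t) (Set.Icc (-1) 1) := by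
    refine ContinuousOn.mul (ContinuousOn.mul (by fun_prop) (ContinuousOn.mul ?_ hg.continuousOn))
      (continuous_legendrePoly_eval n).continuousOn
    exact ((continuous_id.sub continuous_const).abs.rpow_const
      fun _ => Or.inr hα.le).continuousOn
  have hR : ∫ t in ξ..1, (t - ξ) ^ j * modelFun ξ α g t * (legendrePoly n).eval t =
      ∫ t in ξ..1, (legendrePoly n).eval t * ((t - ξ) ^ (α + j) * g t) := by
    refine intervalIntegral.integral_congr fun t ht => ?_
    rw [Set.uIcc_of_le hξ.2.le] at ht
    have h : 0 ≤ t - ξ := sub_nonneg.mpr ht.1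
    simp only [modelFun, abs_of_nonneg h]
    rw [Real.rpow_add_natCast' h (by positivity)]
    ring
  have hL : ∫ t in (-1)..ξ, (t - ξ) ^ j * modelFun ξ α g t * (legendrePoly n).eval t =
      (-1) ^ (n + j) * ∫ t in (-ξ)..1, (legendrePoly n).eval t * ((t - -ξ) ^ (α + j) * g (-t)) := by
    have := intervalIntegral.integral_comp_neg (a := -ξ) (b := 1)
      (fun t => (t - ξ) ^ j * modelFun ξ α g t * (legendrePoly n).eval t)
    rw [neg_neg] at this
    rw [← this, ← intervalIntegral.integral_const_mul]
    refine intervalIntegral.integral_congr fun t ht => ?_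
    rw [Set.uIcc_of_le (by linarith [hξ.1])] at ht
    have h : 0 ≤ t - -ξ := sub_nonneg.mpr ht.1
    simp only [modelFun]
    rw [show -t - ξ = -(t - -ξ) by ring, abs_neg, abs_of_nonneg h, neg_pow,
      legendrePoly_eval_neg, Real.rpow_add_natCast' h (by positivity), pow_add]
    ring
  rw [← intervalIntegral.integral_add_adjacent_intervals (b := ξ), hR, hL]
  · refine (abs_add_le _ _).trans ?_
    rw [abs_mul, abs_pow, abs_neg, abs_one, one_pow, one_mul, add_mul, add_comm]
    exact add_le_add (hC₁ n) (hC₂ n)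
  · apply ContinuousOn.intervalIntegrable_of_Icc hξ.1.le
    exact hcont.mono (Set.Icc_subset_Icc_right hξ.2.le)
  · apply ContinuousOn.intervalIntegrable_of_Icc hξ.2.le
    exact hcont.mono (Set.Icc_subset_Icc_left hξ.1.le)

/-! ### Christoffel–Darboux and pointwise convergence -/

theorem legendrePoly_christoffel_darboux (n : ℕ) (t x : ℝ) :
    (t - x) * ∑ k ∈ Finset.range (n + 1),
      (2 * (k : ℝ) + 1) / 2 * ((legendrePoly k).eval t * (legendrePoly k).eval x) =
    ((n : ℝ) + 1) / 2 * ((legendrePoly (n + 1)).eval t * (legendrePoly n).eval x -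
      (legendrePoly n).eval t * (legendrePoly (n + 1)).eval x) := by
  induction n with
  | zero => simp [legendrePoly_zero, legendrePoly_one]; ring
  | succ n ih =>
    rw [Finset.sum_range_succ, mul_add, ih]
    have h1 := legendrePoly_eval_recurrence n t
    have h2 := legendrePoly_eval_recurrence n x
    push_cast
    linear_combination (-(legendrePoly (n + 1)).eval x / 2) * h1 +
      (legendrePoly (n + 1)).eval t / 2 * h2

theorem integral_legendrePoly_of_pos {n : ℕ} (hn : 1 ≤ n) :
    ∫ t in (-1 : ℝ)..1, (legendrePoly n).eval t = 0 := by
  rw [intervalIntegral.integral_eq_sub_of_hasDerivAt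
    (fun t _ => hasDerivAt_legendrePrim hn t)
    ((continuous_legendrePoly_eval n).intervalIntegrable _ _), legendrePrim_one,
    legendrePrim_neg_one, sub_zero]

theorem ContinuousOn.intervalIntegrable_mul_legendrePoly {f : ℝ → ℝ}
    (hf : ContinuousOn f (Set.Icc (-1) 1)) (n : ℕ) :
    IntervalIntegrable (fun t => f t * (legendrePoly n).eval t) MeasureTheory.volume (-1) 1 :=
  (hf.mul (continuous_legendrePoly_eval n).continuousOn).intervalIntegrable_of_Icc (by norm_num)

theorem legendreProj_const (c : ℝ) (n : ℕ) (x : ℝ) : legendreProj (fun _ => c) n x = c := by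
  rw [legendreProj, Finset.sum_range_succ', Finset.sum_eq_zero, zero_add]
  · simp [legendreCoeff, legendrePoly_zero]; ring
  · intro k _
    simp [legendreCoeff, integral_legendrePoly_of_pos (Nat.succ_le_succ (Nat.zero_le k))]

theorem legendreProj_sub {f g : ℝ → ℝ} (hf : ContinuousOn f (Set.Icc (-1) 1))
    (hg : ContinuousOn g (Set.Icc (-1) 1)) (n : ℕ) (x : ℝ) :
    legendreProj (fun t => f t - g t) n x = legendreProj f n x - legendreProj g n x := by
  simp only [legendreProj, legendreCoeff, ← Finset.sum_sub_distrib, sub_mul]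
  refine Finset.sum_congr rfl fun k _ => ?_
  rw [intervalIntegral.integral_sub (hf.intervalIntegrable_mul_legendrePoly k)
    (hg.intervalIntegrable_mul_legendrePoly k)]
  ring

theorem legendreProj_const_mul (c : ℝ) (f : ℝ → ℝ) (n : ℕ) (x : ℝ) :
    legendreProj (fun t => c * f t) n x = c * legendreProj f n x := by
  simp only [legendreProj, legendreCoeff, Finset.mul_sum, mul_assoc,
    intervalIntegral.integral_const_mul]
  exact Finset.sum_congr rfl fun k _ => by ring

/-- The factor `t - x` cancels the denominator of the Christoffel–Darboux kernel. This serves both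
the pointwise convergence and the commutator estimate. -/
theorem legendreProj_sub_mul {F : ℝ → ℝ} (hF : ContinuousOn F (Set.Icc (-1) 1)) (n : ℕ) (x : ℝ) :
    legendreProj (fun t => (t - x) * F t) n x = ((n : ℝ) + 1) / 2 *
      ((legendrePoly n).eval x * (∫ t in (-1 : ℝ)..1, F t * (legendrePoly (n + 1)).eval t) -
        (legendrePoly (n + 1)).eval x * ∫ t in (-1 : ℝ)..1, F t * (legendrePoly n).eval t) := by
  have hF' : ContinuousOn (fun t => (t - x) * F t) (Set.Icc (-1) 1) :=
    ContinuousOn.mul (by fun_prop) hF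
  have h : legendreProj (fun t => (t - x) * F t) n x =
      ∫ t in (-1 : ℝ)..1, F t * ((t - x) * ∑ k ∈ Finset.range (n + 1),
        (2 * (k : ℝ) + 1) / 2 * ((legendrePoly k).eval t * (legendrePoly k).eval x)) := by
    have : ∀ t, F t * ((t - x) * ∑ k ∈ Finset.range (n + 1),
        (2 * (k : ℝ) + 1) / 2 * ((legendrePoly k).eval t * (legendrePoly k).eval x)) =
        ∑ k ∈ Finset.range (n + 1), (2 * (k : ℝ) + 1) / 2 * (legendrePoly k).eval x *
          ((t - x) * F t * (legendrePoly k).eval t) := fun t => by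
      simp only [Finset.mul_sum]
      exact Finset.sum_congr rfl fun k _ => by ring
    simp only [this]
    rw [intervalIntegral.integral_finsetSum fun k _ =>
      (hF'.intervalIntegrable_mul_legendrePoly k).const_mul _]
    simp only [legendreProj, legendreCoeff, intervalIntegral.integral_const_mul]
    exact Finset.sum_congr rfl fun k _ => by ring
  rw [h]
  simp only [legendrePoly_christoffel_darboux]
  rw [← intervalIntegral.integral_const_mul, ← intervalIntegral.integral_const_mul,
    ← intervalIntegral.integral_sub, ← intervalIntegral.integral_const_mul]
  · exact intervalIntegral.integral_congr fun t _ => by ring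
  · exact (hF.intervalIntegrable_mul_legendrePoly _).const_mul _
  · exact (hF.intervalIntegrable_mul_legendrePoly _).const_mul _

theorem abs_legendrePoly_eval_le_rpow (n : ℕ) {t : ℝ} (ht : t ∈ Set.Ioo (-1 : ℝ) 1) :
    |(legendrePoly n).eval t| ≤ √2 * ((n : ℝ) + 1) ^ (-(1 / 2) : ℝ) *
      ((1 - t) ^ (-(1 / 2) : ℝ) + (1 + t) ^ (-(1 / 2) : ℝ)) := by
  have key {δ : ℝ} (hδ : 0 < δ) (h : δ ≤ 1 - t ^ 2) : |(legendrePoly n).eval t| ≤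
      √2 * ((n : ℝ) + 1) ^ (-(1 / 2) : ℝ) * δ ^ (-(1 / 2) : ℝ) := by
    refine (abs_legendrePoly_eval_le_of_le n hδ h).trans_eq ?_
    rw [Real.sqrt_div' _ hδ.le, Real.rpow_neg hδ.le, ← Real.sqrt_eq_rpow, div_eq_mul_inv]
    ring
  have h1 : 0 < 1 - t := sub_pos.mpr ht.2
  have h2 : 0 < 1 + t := by linarith [ht.1]
  rcases le_total 0 t with h | h
  · refine (key h1 (by nlinarith)).trans ?_
    gcongr
    exact le_add_of_nonneg_right (by positivity)
  · refine (key h2 (by nlinarith)).trans ?_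
    gcongr
    exact le_add_of_nonneg_left (by positivity)

theorem exists_abs_integral_mul_legendrePoly_le :
    ∃ D, 0 ≤ D ∧ ∀ (n : ℕ) (F : ℝ → ℝ) (δ : ℝ), (∀ t ∈ Set.Icc (-1 : ℝ) 1, |F t| ≤ δ) →
      |∫ t in (-1 : ℝ)..1, F t * (legendrePoly n).eval t| ≤
        D * δ * ((n : ℝ) + 1) ^ (-(1 / 2) : ℝ) := by
  have hI : IntervalIntegrable (fun t : ℝ => (1 - t) ^ (-(1 / 2) : ℝ) + (1 + t) ^ (-(1 / 2) : ℝ))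
      MeasureTheory.volume (-1) 1 := by
    have h1 := (intervalIntegral.intervalIntegrable_rpow' (a := 2) (b := 0)
      (r := -(1 / 2)) (by norm_num)).comp_sub_left 1
    have h2 := (intervalIntegral.intervalIntegrable_rpow' (a := 0) (b := 2)
      (r := -(1 / 2)) (by norm_num)).comp_add_left 1
    norm_num at h1 h2
    norm_num
    exact h1.add h2
  refine ⟨√2 * ∫ t in (-1 : ℝ)..1, ((1 - t) ^ (-(1 / 2) : ℝ) + (1 + t) ^ (-(1 / 2) : ℝ)),
    mul_nonneg (by positivity) (intervalIntegral.integral_nonneg (by norm_num) fun t ht => ?_),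
    fun n F δ hF => ?_⟩
  · have h1 : 0 ≤ 1 - t := sub_nonneg.mpr ht.2
    have h2 : 0 ≤ 1 + t := by linarith [ht.1]
    positivity
  have hδ : 0 ≤ δ := (abs_nonneg _).trans (hF 0 (by norm_num))
  have h : |∫ t in (-1 : ℝ)..1, F t * (legendrePoly n).eval t| ≤
      ∫ t in (-1 : ℝ)..1, δ * (√2 * ((n : ℝ) + 1) ^ (-(1 / 2) : ℝ)) *
        ((1 - t) ^ (-(1 / 2) : ℝ) + (1 + t) ^ (-(1 / 2) : ℝ)) := by
    rw [← Real.norm_eq_abs]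
    refine intervalIntegral.norm_integral_le_of_norm_le (by norm_num) ?_ (hI.const_mul _)
    -- The pointwise majorant is available only for `|t| < 1`, so the endpoint `1` is discarded as a
    -- null set.
    filter_upwards [MeasureTheory.compl_mem_ae_iff.mpr (MeasureTheory.measure_singleton (1 : ℝ))] with t ht1 ht
    rw [Real.norm_eq_abs, abs_mul, mul_assoc δ]
    exact mul_le_mul (hF t ⟨ht.1.le, ht.2⟩)
      (abs_legendrePoly_eval_le_rpow n ⟨ht.1, lt_of_le_of_ne ht.2 ht1⟩) (abs_nonneg _) hδ
  refine h.trans_eq ?_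
  rw [intervalIntegral.integral_const_mul]
  ring

theorem exists_abs_integral_polynomial_mul_legendrePoly_le (q : Polynomial ℝ) :
    ∃ C, ∀ n : ℕ, 1 ≤ n → |∫ t in (-1 : ℝ)..1, q.eval t * (legendrePoly n).eval t| ≤
      C * ((n : ℝ) + 1) ^ (-(3 / 2) : ℝ) := by
  obtain ⟨M, hM0, hM⟩ := exists_abs_le_of_continuousOn_Icc (a := -1) (b := 1)
    q.derivative.continuous.continuousOn
  refine ⟨8 * M, fun n hn => ?_⟩
  rw [intervalIntegral.integral_mul_deriv_eq_deriv_mul (fun t _ => q.hasDerivAt t)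
    (fun t _ => hasDerivAt_legendrePrim hn t) (q.derivative.continuous.intervalIntegrable _ _)
    ((continuous_legendrePoly_eval n).intervalIntegrable _ _), legendrePrim_one,
    legendrePrim_neg_one, mul_zero, mul_zero, sub_zero, zero_sub, abs_neg, ← Real.norm_eq_abs]
  refine (intervalIntegral.norm_integral_le_of_norm_le_const
    (C := M * (4 * ((n : ℝ) + 1) ^ (-(3 / 2) : ℝ))) fun t ht => ?_).trans_eq ?_
  · rw [Set.uIoc_of_le (by norm_num)] at ht
    rw [Real.norm_eq_abs, abs_mul]
    gcongr
    · exact hM t ⟨ht.1.le, ht.2⟩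
    · exact abs_legendrePrim_le hn ⟨ht.1.le, ht.2⟩
  · norm_num
    ring

/-- A Riemann–Lebesgue statement at the scale `n^(-1/2)`: a polynomial contributes `O(n^(-3/2))`,
and the uniformly small Weierstrass remainder at most a small multiple of `n^(-1/2)`. -/
theorem tendsto_sqrt_mul_integral_mul_legendrePoly {h : ℝ → ℝ}
    (hh : ContinuousOn h (Set.Icc (-1) 1)) :
    Filter.Tendsto (fun n : ℕ => ((n : ℝ) + 1) ^ (1 / 2 : ℝ) *
      |∫ t in (-1 : ℝ)..1, h t * (legendrePoly n).eval t|) Filter.atTop (nhds 0) := by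
  obtain ⟨D, hD0, hD⟩ := exists_abs_integral_mul_legendrePoly_le
  rw [Metric.tendsto_atTop]
  intro ε hε
  set δ := ε / (2 * (D + 1)) with hδ
  have hδ0 : 0 < δ := by positivity
  obtain ⟨q, hq⟩ := exists_polynomial_near_of_continuousOn (-1) 1 h hh δ hδ0
  obtain ⟨C, hC⟩ := exists_abs_integral_polynomial_mul_legendrePoly_le q
  obtain ⟨N, hN⟩ := exists_nat_gt (2 * |C| / ε)
  refine ⟨N + 1, fun n hn => ?_⟩
  have hn1 : 1 ≤ n := by omega
  have hn0 : (0 : ℝ) < (n : ℝ) + 1 := by positivity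
  have hnN : (N : ℝ) + 1 ≤ n := by exact_mod_cast hn
  have hqc : ContinuousOn (fun t => q.eval t) (Set.Icc (-1 : ℝ) 1) := q.continuous.continuousOn
  have hd : ContinuousOn (fun t => h t - q.eval t) (Set.Icc (-1 : ℝ) 1) := hh.sub hqc
  have hsplit : ∫ t in (-1 : ℝ)..1, h t * (legendrePoly n).eval t =
      (∫ t in (-1 : ℝ)..1, (h t - q.eval t) * (legendrePoly n).eval t) +
      ∫ t in (-1 : ℝ)..1, q.eval t * (legendrePoly n).eval t := by
    rw [← intervalIntegral.integral_add
      (hd.intervalIntegrable_mul_legendrePoly n)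
      (hqc.intervalIntegrable_mul_legendrePoly n)]
    exact intervalIntegral.integral_congr fun t _ => by ring
  have h1 := hD n (fun t => h t - q.eval t) δ fun t ht => by
    rw [abs_sub_comm]; exact (hq t ht).le
  have h2 := hC n hn1
  have hp := Real.rpow_pos_of_pos hn0 (1 / 2)
  have e1 : ((n : ℝ) + 1) ^ (1 / 2 : ℝ) * ((n : ℝ) + 1) ^ (-(1 / 2) : ℝ) = 1 := by
    rw [← Real.rpow_add hn0]; norm_num
  have e2 : ((n : ℝ) + 1) ^ (1 / 2 : ℝ) * ((n : ℝ) + 1) ^ (-(3 / 2) : ℝ) = ((n : ℝ) + 1)⁻¹ := by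
    rw [← Real.rpow_add hn0, ← Real.rpow_neg_one]; norm_num
  rw [Real.dist_eq, sub_zero, abs_of_nonneg (by positivity), hsplit]
  calc _ ≤ ((n : ℝ) + 1) ^ (1 / 2 : ℝ) * (D * δ * ((n : ℝ) + 1) ^ (-(1 / 2) : ℝ) +
        C * ((n : ℝ) + 1) ^ (-(3 / 2) : ℝ)) := by
        gcongr
        exact (abs_add_le _ _).trans (add_le_add h1 h2)
    _ = D * δ + C * ((n : ℝ) + 1)⁻¹ := by
        linear_combination D * δ * e1 + C * e2
    _ < ε / 2 + ε / 2 := by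
        refine add_lt_add_of_le_of_lt ?_ ?_
        · rw [hδ, ← mul_div_assoc, div_le_div_iff₀ (by positivity) (by norm_num)]
          nlinarith
        · rw [← div_eq_mul_inv, div_lt_iff₀ hn0]
          rw [div_lt_iff₀ hε] at hN
          nlinarith [le_abs_self C]
    _ = ε := by ring

/-- Differentiability makes the difference quotient `h` at `x` continuous, and the error is the
projection of `(t - x) h(t)`. In its boundary terms the prefactor `n * |P_n(x)|` is `O(n^(1/2))`,
which the Riemann–Lebesgue decay beats. -/
theorem tendsto_legendreProj {f : ℝ → ℝ} (hf : ContinuousOn f (Set.Icc (-1) 1)) {x : ℝ}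
    (hx : x ∈ Set.Ioo (-1 : ℝ) 1) (hfx : DifferentiableAt ℝ f x) :
    Filter.Tendsto (fun n => legendreProj f n x) Filter.atTop (nhds (f x)) := by
  have hh : ContinuousOn (dslope f x) (Set.Icc (-1) 1) :=
    (continuousOn_dslope (Icc_mem_nhds hx.1 hx.2)).mpr ⟨hf, hfx⟩
  have herr (n : ℕ) : legendreProj f n x - f x = ((n : ℝ) + 1) / 2 *
      ((legendrePoly n).eval x *
          (∫ t in (-1 : ℝ)..1, dslope f x t * (legendrePoly (n + 1)).eval t) -
        (legendrePoly (n + 1)).eval x *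
          ∫ t in (-1 : ℝ)..1, dslope f x t * (legendrePoly n).eval t) := by
    rw [← legendreProj_sub_mul hh]
    have h : (fun t => (t - x) * dslope f x t) = fun t => f t - f x :=
      funext fun t => sub_smul_dslope f x t
    rw [h, legendreProj_sub hf continuousOn_const, legendreProj_const]
  have hδ : 0 < 1 - x ^ 2 := by nlinarith [hx.1, hx.2]
  set K := √(2 / (1 - x ^ 2)) with hK
  have hb := tendsto_sqrt_mul_integral_mul_legendrePoly hh
  set b : ℕ → ℝ := fun n => ((n : ℝ) + 1) ^ (1 / 2 : ℝ) *
      |∫ t in (-1 : ℝ)..1, dslope f x t * (legendrePoly n).eval t| with hbdef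
  have hlim : Filter.Tendsto (fun n => K / 2 * (b (n + 1) + b n)) Filter.atTop (nhds 0) := by
    simpa using ((hb.comp (Filter.tendsto_add_atTop_nat 1)).add hb).const_mul (K / 2)
  rw [tendsto_iff_dist_tendsto_zero]
  refine squeeze_zero (fun _ => dist_nonneg) (fun n => ?_) hlim
  have hn0 : (0 : ℝ) < (n : ℝ) + 1 := by positivity
  have h1 := abs_legendrePoly_eval_le_of_le n hδ le_rfl
  have h2 := abs_legendrePoly_eval_le_of_le (n + 1) hδ le_rfl
  have e1 : ((n : ℝ) + 1) * ((n : ℝ) + 1) ^ (-(1 / 2) : ℝ) = ((n : ℝ) + 1) ^ (1 / 2 : ℝ) := by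
    rw [mul_comm, ← Real.rpow_add_one hn0.ne']; norm_num
  have h3 : (((n + 1 : ℕ) : ℝ) + 1) ^ (-(1 / 2) : ℝ) ≤ ((n : ℝ) + 1) ^ (-(1 / 2) : ℝ) :=
    Real.rpow_le_rpow_of_nonpos hn0 (by push_cast; linarith) (by norm_num)
  have h4 : ((n : ℝ) + 1) ^ (1 / 2 : ℝ) ≤ (((n + 1 : ℕ) : ℝ) + 1) ^ (1 / 2 : ℝ) :=
    Real.rpow_le_rpow hn0.le (by push_cast; linarith) (by norm_num)
  rw [Real.dist_eq, herr, abs_mul, abs_of_pos (by positivity : 0 < ((n : ℝ) + 1) / 2)]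
  set A := ∫ t in (-1 : ℝ)..1, dslope f x t * (legendrePoly n).eval t with hA
  set B := ∫ t in (-1 : ℝ)..1, dslope f x t * (legendrePoly (n + 1)).eval t with hB
  calc _ ≤ ((n : ℝ) + 1) / 2 * (|(legendrePoly n).eval x| * |B| +
        |(legendrePoly (n + 1)).eval x| * |A|) := by
        gcongr
        rw [← abs_mul, ← abs_mul]
        exact abs_sub _ _
    _ ≤ ((n : ℝ) + 1) / 2 * ((K * ((n : ℝ) + 1) ^ (-(1 / 2) : ℝ)) * |B| +
        (K * ((n : ℝ) + 1) ^ (-(1 / 2) : ℝ)) * |A|) := by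
        gcongr
        exact h2.trans (by gcongr)
    _ = K / 2 * (((n : ℝ) + 1) ^ (1 / 2 : ℝ) * |B| + ((n : ℝ) + 1) ^ (1 / 2 : ℝ) * |A|) := by
        rw [← e1]; ring
    _ ≤ _ := by
        simp only [hbdef]
        gcongr

/-! ### Tail sums and the error away from and near the singularity -/

theorem sum_Ico_rpow_neg_le {s : ℝ} (hs : 1 < s) {n N : ℕ} (hn : n ≤ N) :
    ∑ k ∈ Finset.Ico (n + 1) (N + 1), ((k : ℝ) + 1) ^ (-s) ≤ ((n : ℝ) + 1) ^ (1 - s) / (s - 1) := by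
  have hn0 : (0 : ℝ) < (n : ℝ) + 1 := by positivity
  have hs1 : 0 < s - 1 := sub_pos.mpr hs
  have hle : ((n + 1 : ℕ) : ℝ) ≤ ((N + 1 : ℕ) : ℝ) := by exact_mod_cast Nat.succ_le_succ hn
  have h := AntitoneOn.sum_le_integral_Ico (f := fun x : ℝ => x ^ (-s)) (Nat.succ_le_succ hn)
    (fun a ha b _ hab => Real.rpow_le_rpow_of_nonpos (lt_of_lt_of_le (by positivity) ha.1) hab
      (by linarith))
  have h0 : (0 : ℝ) ∉ Set.uIcc ((n + 1 : ℕ) : ℝ) ((N + 1 : ℕ) : ℝ) := by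
    rw [Set.uIcc_of_le hle]
    intro h
    have := h.1
    push_cast at this
    linarith
  rw [Nat.succ_eq_add_one, Nat.succ_eq_add_one, integral_rpow (Or.inr ⟨by linarith, h0⟩)] at h
  push_cast at h
  refine h.trans ?_
  have h1 : 0 ≤ ((N : ℝ) + 1) ^ (-s + 1) := by positivity
  rw [show (1 - s) = -s + 1 by ring, ← neg_div_neg_eq, show -(-s + 1) = s - 1 by ring]
  gcongr
  linarith

/-- The factor `(2k+1)/2` makes the terms `O(k^(1-γ-σ))`, summable exactly under `hγ`; convergence
lets the error be bounded as a limit of finite tails. -/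
theorem abs_sub_legendreProj_le {f : ℝ → ℝ} {C K γ σ x : ℝ} (hγ : 2 < γ + σ)
    (hC : ∀ k : ℕ, |∫ t in (-1 : ℝ)..1, f t * (legendrePoly k).eval t| ≤
      C * ((k : ℝ) + 1) ^ (-γ))
    (hK : ∀ k : ℕ, |(legendrePoly k).eval x| ≤ K * ((k : ℝ) + 1) ^ (-σ))
    (hlim : Filter.Tendsto (fun n => legendreProj f n x) Filter.atTop (nhds (f x))) (n : ℕ) :
    |f x - legendreProj f n x| ≤ C * K / (γ + σ - 2) * ((n : ℝ) + 1) ^ (2 - γ - σ) := by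
  have hC0 : 0 ≤ C := by simpa using (abs_nonneg _).trans (hC 0)
  have hK0 : 0 ≤ K := by simpa using (abs_nonneg _).trans (hK 0)
  refine le_of_tendsto ((hlim.sub_const _).abs) ?_
  filter_upwards [Filter.eventually_ge_atTop n] with N hN
  have hterm (k : ℕ) : |legendreCoeff f k * (legendrePoly k).eval x| ≤
      C * K * ((k : ℝ) + 1) ^ (-(γ + σ - 1)) := by
    have hk : (0 : ℝ) < (k : ℝ) + 1 := by positivity
    rw [legendreCoeff, abs_mul, abs_mul, abs_of_pos (by positivity : (0 : ℝ) < (2 * k + 1) / 2)]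
    calc _ ≤ ((k : ℝ) + 1) * (C * ((k : ℝ) + 1) ^ (-γ)) * (K * ((k : ℝ) + 1) ^ (-σ)) := by
          gcongr
          · linarith
          · exact hC k
          · exact hK k
      _ = C * K * (((k : ℝ) + 1) ^ (-γ) * ((k : ℝ) + 1) ^ (-σ) * ((k : ℝ) + 1)) := by ring
      _ = _ := by
          rw [← Real.rpow_add hk, ← Real.rpow_add_one hk.ne']
          congr 2; ring
  rw [legendreProj, legendreProj, ← Finset.sum_Ico_eq_sub _ (Nat.succ_le_succ hN)]
  calc _ ≤ ∑ k ∈ Finset.Ico (n + 1) (N + 1), C * K * ((k : ℝ) + 1) ^ (-(γ + σ - 1)) :=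
        (Finset.abs_sum_le_sum_abs _ _).trans (Finset.sum_le_sum fun k _ => hterm k)
    _ ≤ C * K * (((n : ℝ) + 1) ^ (1 - (γ + σ - 1)) / (γ + σ - 1 - 1)) := by
        rw [← Finset.mul_sum]
        gcongr
        exact sum_Ico_rpow_neg_le (by linarith) hN
    _ = _ := by
        rw [show 1 - (γ + σ - 1) = 2 - γ - σ by ring, show γ + σ - 1 - 1 = γ + σ - 2 by ring]
        ring

/-- Removing `ξ` and the endpoints leaves a dense subset of `V ∩ [a, b]`. This recovers the points
where pointwise convergence was not proved. -/
theorem ContinuousOn.le_of_forall_mem_Ioo_ne {φ : ℝ → ℝ} {a b ξ B : ℝ} (hab : a < b)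
    (hφ : ContinuousOn φ (Set.Icc a b)) {V : Set ℝ} (hV : IsOpen V)
    (h : ∀ y ∈ V ∩ Set.Ioo a b, y ≠ ξ → φ y ≤ B) {x : ℝ} (hxV : x ∈ V) (hx : x ∈ Set.Icc a b) :
    φ x ≤ B := by
  have h1 : x ∈ closure (V ∩ Set.Ioo a b) :=
    hV.inter_closure ⟨hxV, by rwa [closure_Ioo hab.ne]⟩
  have h2 : x ∈ closure (V ∩ Set.Ioo a b ∩ {ξ}ᶜ) :=
    closure_minimal ((dense_compl_singleton ξ).open_subset_closure_inter (hV.inter isOpen_Ioo))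
      isClosed_closure h1
  refine ContinuousWithinAt.closure_le h2 ((hφ x hx).mono fun y hy => ?_)
    continuousWithinAt_const fun y hy => h y hy.1 hy.2
  exact ⟨hy.1.2.1.le, hy.1.2.2.le⟩

theorem continuous_legendreProj (f : ℝ → ℝ) (n : ℕ) : Continuous (legendreProj f n) :=
  continuous_finsetSum _ fun k _ => continuous_const.mul (continuous_legendrePoly_eval k)

theorem continuousOn_modelFun {ξ α : ℝ} (hα : 0 < α) {g : ℝ → ℝ} {s : Set ℝ}
    (hg : ContinuousOn g s) : ContinuousOn (modelFun ξ α g) s :=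
  ((continuous_id.sub continuous_const).abs.rpow_const fun _ => Or.inr hα.le).continuousOn.mul hg

theorem differentiableAt_modelFun {ξ α x : ℝ} {g : ℝ → ℝ} (hx : x ≠ ξ)
    (hg : DifferentiableAt ℝ g x) : DifferentiableAt ℝ (modelFun ξ α g) x := by
  have h : x - ξ ≠ 0 := sub_ne_zero.mpr hx
  have h1 : DifferentiableAt ℝ (fun t => |t - ξ|) x :=
    (differentiableAt_abs h).comp x (differentiableAt_id.sub_const ξ)
  exact (h1.rpow_const (Or.inl (abs_pos.mpr h).ne')).mul hg

/-- The commutator estimate. `C` is chosen before `x`, `K` and `σ`, so one constant serves `σ = 0`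
near the endpoints and `σ = 1/2` in the interior. -/
theorem exists_sq_mul_abs_sub_legendreProj_modelFun_le {k : ℕ} {ξ : ℝ}
    (hξ : ξ ∈ Set.Ioo (-1 : ℝ) 1) {α : ℝ} (hα : 0 < α) (hk : α + 2 ≤ k) {g : ℝ → ℝ}
    (hg : ContDiffOn ℝ (k + 1 : ℕ) g (Set.Icc (-1) 1)) :
    ∃ C, 0 ≤ C ∧ ∀ x ∈ Set.Icc (-1 : ℝ) 1, ∀ K σ : ℝ, 0 ≤ σ →
      (∀ j : ℕ, |(legendrePoly j).eval x| ≤ K * ((j : ℝ) + 1) ^ (-σ)) → ∀ n : ℕ,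
      (x - ξ) ^ 2 * |modelFun ξ α g x - legendreProj (modelFun ξ α g) n x| ≤
        C * K * ((n : ℝ) + 1) ^ (-α - 1 / 2 - σ) + C * ((n : ℝ) + 1) ^ (-α - 3 / 2) := by
  obtain ⟨C₀, hC₀⟩ := exists_bound_integral_sub_pow_mul_modelFun_mul_legendrePoly hξ hα
    (j := 0) (by push_cast; linarith) hg
  obtain ⟨C₁, hC₁⟩ := exists_bound_integral_sub_pow_mul_modelFun_mul_legendrePoly hξ hα
    (j := 1) (by push_cast; linarith) hg
  obtain ⟨C₂, hC₂⟩ := exists_bound_integral_sub_pow_mul_modelFun_mul_legendrePoly hξ hα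
    (j := 2) (by push_cast; linarith) hg
  set f := modelFun ξ α g with hf
  have hfc : ContinuousOn f (Set.Icc (-1) 1) := continuousOn_modelFun hα hg.continuousOn
  set v : ℝ → ℝ := fun t => (t - ξ) ^ 2 * f t with hv
  have hvc : ContinuousOn v (Set.Icc (-1) 1) := ContinuousOn.mul (by fun_prop) hfc
  have hC₀0 : 0 ≤ C₀ := by simpa using (abs_nonneg _).trans (hC₀ 0)
  have hC₁0 : 0 ≤ C₁ := by simpa using (abs_nonneg _).trans (hC₁ 0)
  have hC₂0 : 0 ≤ C₂ := by simpa using (abs_nonneg _).trans (hC₂ 0)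
  have hverr (n : ℕ) (x : ℝ) (hx : x ∈ Set.Icc (-1 : ℝ) 1) :
      |v x - legendreProj v n x| ≤ C₂ / (α + 3 / 2) * ((n : ℝ) + 1) ^ (-α - 3 / 2) := by
    refine ContinuousOn.le_of_forall_mem_Ioo_ne (φ := fun x => |v x - legendreProj v n x|)
      (V := Set.univ) (ξ := ξ) (by norm_num)
      (hvc.sub (continuous_legendreProj v n).continuousOn).abs isOpen_univ
      (fun y hy hyξ => ?_) (Set.mem_univ x) hx
    have hgy : DifferentiableAt ℝ g y :=
      (hasDerivAt_of_contDiffOn_Icc hg hy.2).differentiableAt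
    have hlim := tendsto_legendreProj hvc hy.2
      (DifferentiableAt.mul (by fun_prop) (differentiableAt_modelFun hyξ hgy))
    have := abs_sub_legendreProj_le (f := v) (C := C₂) (K := 1) (γ := α + 2 + 3 / 2) (σ := 0)
      (by linarith) (fun k => (hC₂ k).trans_eq (by congr 2; push_cast; ring))
      (fun k => by simpa using abs_legendrePoly_eval_le_one k ⟨hy.2.1.le, hy.2.2.le⟩) hlim n
    refine this.trans_eq ?_
    rw [show 2 - (α + 2 + 3 / 2) - 0 = -α - 3 / 2 by ring,
      show α + 2 + 3 / 2 + 0 - 2 = α + 3 / 2 by ring, mul_one]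
  refine ⟨max (C₁ + 2 * C₀) (C₂ / (α + 3 / 2)), le_max_of_le_left (by positivity),
    fun x hx K σ hσ hK n => ?_⟩
  have hK0 : 0 ≤ K := by simpa using (abs_nonneg _).trans (hK 0)
  have hn0 : (0 : ℝ) < (n : ℝ) + 1 := by positivity
  set y := x - ξ with hy
  have hy2 : |y| ≤ 2 := by
    rw [abs_le]; constructor <;> linarith [hx.1, hx.2, hξ.1, hξ.2]
  -- From `(t - ξ)^2 - y^2 = (t - x)(t - ξ + y)`; the powers `1` and `0` are kept to match the
  -- moment bounds.
  set F : ℝ → ℝ := fun t => (t - ξ) ^ 1 * f t + y * ((t - ξ) ^ 0 * f t) with hF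
  have hFc : ContinuousOn F (Set.Icc (-1) 1) :=
    (ContinuousOn.mul (by fun_prop) hfc).add
      (continuousOn_const.mul (ContinuousOn.mul (by fun_prop) hfc))
  have hA (j : ℕ) (hj : n ≤ j) : |∫ t in (-1 : ℝ)..1, F t * (legendrePoly j).eval t| ≤
      (C₁ + 2 * C₀) * ((n : ℝ) + 1) ^ (-α - 3 / 2) := by
    have hj' : (n : ℝ) + 1 ≤ (j : ℝ) + 1 := by exact_mod_cast Nat.succ_le_succ hj
    have hsum : ∫ t in (-1 : ℝ)..1, F t * (legendrePoly j).eval t =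
        (∫ t in (-1 : ℝ)..1, (t - ξ) ^ 1 * f t * (legendrePoly j).eval t) +
        y * ∫ t in (-1 : ℝ)..1, (t - ξ) ^ 0 * f t * (legendrePoly j).eval t := by
      rw [← intervalIntegral.integral_const_mul, ← intervalIntegral.integral_add]
      · exact intervalIntegral.integral_congr fun t _ => by simp only [hF]; ring
      · exact ContinuousOn.intervalIntegrable_mul_legendrePoly
          (ContinuousOn.mul (by fun_prop) hfc) j
      · exact (ContinuousOn.intervalIntegrable_mul_legendrePoly
          (ContinuousOn.mul (by fun_prop) hfc) j).const_mul y
    have p1 : ((j : ℝ) + 1) ^ (-(α + (1 : ℕ)) - 3 / 2) ≤ ((n : ℝ) + 1) ^ (-α - 3 / 2) :=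
      (Real.rpow_le_rpow_of_exponent_le (by linarith) (by push_cast; linarith)).trans
        (Real.rpow_le_rpow_of_nonpos hn0 hj' (by linarith))
    have p0 : ((j : ℝ) + 1) ^ (-(α + (0 : ℕ)) - 3 / 2) ≤ ((n : ℝ) + 1) ^ (-α - 3 / 2) := by
      push_cast
      rw [add_zero]
      exact Real.rpow_le_rpow_of_nonpos hn0 hj' (by linarith)
    rw [hsum, add_mul]
    refine (abs_add_le _ _).trans (add_le_add ((hC₁ j).trans (by gcongr)) ?_)
    rw [abs_mul, mul_assoc]
    gcongr
    exact (hC₀ j).trans (by gcongr)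
  have hdiff : legendreProj v n x - y ^ 2 * legendreProj f n x = ((n : ℝ) + 1) / 2 *
      ((legendrePoly n).eval x * (∫ t in (-1 : ℝ)..1, F t * (legendrePoly (n + 1)).eval t) -
        (legendrePoly (n + 1)).eval x * ∫ t in (-1 : ℝ)..1, F t * (legendrePoly n).eval t) := by
    have hyf : ContinuousOn (fun t => y ^ 2 * f t) (Set.Icc (-1) 1) := continuousOn_const.mul hfc
    rw [← legendreProj_sub_mul hFc, ← legendreProj_const_mul, ← legendreProj_sub hvc hyf]
    congr 1
    funext t
    simp only [hv, hF, hy]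
    ring
  have hmain : |legendreProj v n x - y ^ 2 * legendreProj f n x| ≤
      (C₁ + 2 * C₀) * K * ((n : ℝ) + 1) ^ (-α - 1 / 2 - σ) := by
    have h1 : |(legendrePoly (n + 1)).eval x| ≤ K * ((n : ℝ) + 1) ^ (-σ) :=
      (hK (n + 1)).trans (mul_le_mul_of_nonneg_left
        (Real.rpow_le_rpow_of_nonpos hn0 (by push_cast; linarith) (by linarith)) hK0)
    rw [hdiff, abs_mul, abs_of_pos (by positivity : 0 < ((n : ℝ) + 1) / 2)]
    set A := ∫ t in (-1 : ℝ)..1, F t * (legendrePoly (n + 1)).eval t with hAdef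
    set B := ∫ t in (-1 : ℝ)..1, F t * (legendrePoly n).eval t with hBdef
    have hA1 := hA (n + 1) n.le_succ
    have hA0 := hA n le_rfl
    calc _ ≤ ((n : ℝ) + 1) / 2 * (|(legendrePoly n).eval x| * |A| +
          |(legendrePoly (n + 1)).eval x| * |B|) := by
          gcongr
          rw [← abs_mul, ← abs_mul]
          exact abs_sub _ _
      _ ≤ ((n : ℝ) + 1) / 2 *
          (K * ((n : ℝ) + 1) ^ (-σ) * ((C₁ + 2 * C₀) * ((n : ℝ) + 1) ^ (-α - 3 / 2)) +
          K * ((n : ℝ) + 1) ^ (-σ) * ((C₁ + 2 * C₀) * ((n : ℝ) + 1) ^ (-α - 3 / 2))) := by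
          gcongr
          exact hK n
      _ = (C₁ + 2 * C₀) * K *
          (((n : ℝ) + 1) ^ (-σ) * ((n : ℝ) + 1) ^ (-α - 3 / 2) * ((n : ℝ) + 1)) := by ring
      _ = _ := by
          rw [← Real.rpow_add hn0, ← Real.rpow_add_one hn0.ne']
          congr 2; ring
  calc _ = |(v x - legendreProj v n x) + (legendreProj v n x - y ^ 2 * legendreProj f n x)| := by
        rw [← abs_of_nonneg (sq_nonneg y), ← abs_mul, abs_of_nonneg (sq_nonneg y)]
        congr 1
        simp only [hv, hy]
        ring
    _ ≤ C₂ / (α + 3 / 2) * ((n : ℝ) + 1) ^ (-α - 3 / 2) +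
        (C₁ + 2 * C₀) * K * ((n : ℝ) + 1) ^ (-α - 1 / 2 - σ) :=
        (abs_add_le _ _).trans (add_le_add (hverr n x hx) hmain)
    _ ≤ max (C₁ + 2 * C₀) (C₂ / (α + 3 / 2)) * ((n : ℝ) + 1) ^ (-α - 3 / 2) +
        max (C₁ + 2 * C₀) (C₂ / (α + 3 / 2)) * K * ((n : ℝ) + 1) ^ (-α - 1 / 2 - σ) := by
        gcongr
        · exact le_max_right _ _
        · exact le_max_left _ _
    _ = _ := add_comm _ _

theorem exists_abs_sub_legendreProj_modelFun_le_of_abs_sub_lt {k : ℕ} {ξ : ℝ}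
    (hξ : ξ ∈ Set.Ioo (-1 : ℝ) 1) {α : ℝ} (hα : 0 < α) (hk : α ≤ k) {g : ℝ → ℝ}
    (hg : ContDiffOn ℝ (k + 1 : ℕ) g (Set.Icc (-1) 1)) {ε : ℝ} (hε : ε < 1 - |ξ|) :
    ∃ C, ∀ n : ℕ, ∀ x ∈ Set.Icc (-1 : ℝ) 1, |x - ξ| < ε →
      |modelFun ξ α g x - legendreProj (modelFun ξ α g) n x| ≤ C * ((n : ℝ) + 1) ^ (-α) := by
  obtain ⟨C₀, hC₀⟩ := exists_bound_integral_sub_pow_mul_modelFun_mul_legendrePoly hξ hα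
    (j := 0) (by push_cast; linarith) hg
  have hfc : ContinuousOn (modelFun ξ α g) (Set.Icc (-1) 1) :=
    continuousOn_modelFun hα hg.continuousOn
  refine ⟨C₀ * √(2 / (1 - |ξ| - ε)) / α, fun n x hx hxε => ?_⟩
  refine ContinuousOn.le_of_forall_mem_Ioo_ne
    (φ := fun x => |modelFun ξ α g x - legendreProj (modelFun ξ α g) n x|)
    (V := {x | |x - ξ| < ε}) (ξ := ξ) (by norm_num)
    (hfc.sub (continuous_legendreProj _ n).continuousOn).abs
    (isOpen_lt (by fun_prop) continuous_const) (fun y hy hyξ => ?_) hxε hx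
  have hlim := tendsto_legendreProj hfc hy.2
    (differentiableAt_modelFun hyξ (hasDerivAt_of_contDiffOn_Icc hg hy.2).differentiableAt)
  have hy1 : |y| ≤ |ξ| + ε := by
    have h1 := abs_add_le ξ (y - ξ)
    have h2 : |y - ξ| < ε := hy.1
    rw [add_sub_cancel] at h1
    linarith
  -- Since `|y| ≤ 1`, `1 - y^2 ≥ 1 - |y|`, so the interior bound holds uniformly on the
  -- neighbourhood of `ξ`.
  have hδ : 1 - |ξ| - ε ≤ 1 - y ^ 2 := by
    have : |y| ≤ 1 := by linarith
    rw [← sq_abs y]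
    nlinarith [abs_nonneg y]
  have := abs_sub_legendreProj_le (γ := α + 3 / 2) (σ := 1 / 2) (by linarith)
    (fun k => by
      refine le_trans (le_of_eq ?_) ((hC₀ k).trans_eq ?_)
      · simp
      · congr 2; push_cast; ring)
    (fun k => abs_legendrePoly_eval_le_of_le k (by linarith) hδ) hlim n
  refine this.trans_eq ?_
  rw [show 2 - (α + 3 / 2) - 1 / 2 = -α by ring, show α + 3 / 2 + 1 / 2 - 2 = α by ring]

/-! ### The three regimes -/

theorem mainTheorem4 (α : ℝ) (hα : 0 < α) (hα_even : ∀ k : ℕ, α ≠ 2 * (k : ℝ)) :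
    ∃ m : ℕ, ∀ ξ ∈ Set.Ioo (-1 : ℝ) 1, ∀ g : ℝ → ℝ,
      ContDiffOn ℝ (m : WithTop ℕ∞) g (Set.Icc (-1) 1) →
      ∀ ε : ℝ, 0 < ε → ε < 1 - |ξ| →
        ∃ C : ℝ, ∀ n : ℕ, 1 ≤ n → ∀ x ∈ Set.Icc (-1 : ℝ) 1,
          (|x - ξ| < ε →
            |modelFun ξ α g x - legendreProj (modelFun ξ α g) n x| ≤ C * (n : ℝ) ^ (-α)) ∧
          (|x - 1| < ε ∨ |x + 1| < ε →
            |modelFun ξ α g x - legendreProj (modelFun ξ α g) n x|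
              ≤ C * (n : ℝ) ^ (-α - 1 / 2)) ∧
          (ε ≤ |x - ξ| ∧ ε ≤ |x - 1| ∧ ε ≤ |x + 1| →
            |modelFun ξ α g x - legendreProj (modelFun ξ α g) n x|
              ≤ C * (n : ℝ) ^ (-α - 1)) := by
  -- The `2` pays for the factor `(t - ξ)^2`, the `1` for the base case of the integral estimate.
  refine ⟨⌈α⌉₊ + 2 + 1, fun ξ hξ g hg ε hε0 hε => ?_⟩
  have hceil := Nat.le_ceil α
  obtain ⟨C₁, hC₁⟩ := exists_abs_sub_legendreProj_modelFun_le_of_abs_sub_lt hξ hα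
    (by push_cast; linarith) hg hε
  obtain ⟨C₂, hC₂0, hC₂⟩ := exists_sq_mul_abs_sub_legendreProj_modelFun_le hξ hα
    (by push_cast; linarith) hg
  -- A lower bound for `|x - ξ|` in both remaining regimes: points within `ε` of `±1` are at least
  -- `1 - |ξ| - ε` from `ξ`.
  set d := min ε (1 - |ξ| - ε) with hd
  have hd0 : 0 < d := lt_min hε0 (by linarith)
  set K := √(2 / ε ^ 2) with hK
  set C := max C₁ (max ((C₂ * 1 + C₂) / d ^ 2) ((C₂ * K + C₂) / d ^ 2)) with hC
  have h2 : 0 ≤ (C₂ * 1 + C₂) / d ^ 2 := by positivity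
  have hC0 : 0 ≤ C := le_max_of_le_right (le_max_of_le_left h2)
  refine ⟨C, fun n hn x hx => ?_⟩
  have hn1 : (1 : ℝ) ≤ n := by exact_mod_cast hn
  have hn0 : (0 : ℝ) < n := by linarith
  have hpow {p q : ℝ} (hp : p ≤ 0) (hpq : q ≤ p) : ((n : ℝ) + 1) ^ q ≤ (n : ℝ) ^ p :=
    (Real.rpow_le_rpow_of_exponent_le (by linarith) hpq).trans
      (Real.rpow_le_rpow_of_nonpos hn0 (by linarith) hp)
  have hξ1 := le_abs_self ξ
  have hξ2 := neg_abs_le ξ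
  have haway {K' σ : ℝ} (hσ : 0 ≤ σ) (hσ1 : σ ≤ 1) (hxd : d ≤ |x - ξ|)
      (hK' : ∀ j : ℕ, |(legendrePoly j).eval x| ≤ K' * ((j : ℝ) + 1) ^ (-σ)) :
      |modelFun ξ α g x - legendreProj (modelFun ξ α g) n x| ≤
        (C₂ * K' + C₂) / d ^ 2 * (n : ℝ) ^ (-α - 1 / 2 - σ) := by
    have h := hC₂ x hx K' σ hσ hK' n
    have hK0 : 0 ≤ K' := by simpa using (abs_nonneg _).trans (hK' 0)
    have hsq : d ^ 2 ≤ (x - ξ) ^ 2 := by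
      rw [← sq_abs (x - ξ)]
      exact pow_le_pow_left₀ hd0.le hxd 2
    rw [div_mul_eq_mul_div, le_div_iff₀ (by positivity), mul_comm]
    calc _ ≤ (x - ξ) ^ 2 * |modelFun ξ α g x - legendreProj (modelFun ξ α g) n x| := by gcongr
      _ ≤ _ := h
      _ ≤ C₂ * K' * (n : ℝ) ^ (-α - 1 / 2 - σ) + C₂ * (n : ℝ) ^ (-α - 1 / 2 - σ) := by
          have p1 := hpow (p := -α - 1 / 2 - σ) (q := -α - 1 / 2 - σ) (by linarith) le_rfl
          have p2 := hpow (p := -α - 1 / 2 - σ) (q := -α - 3 / 2) (by linarith) (by linarith)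
          gcongr
      _ = _ := by ring
  refine ⟨fun h => ?_, fun h => ?_, fun h => ?_⟩
  · have hc : C₁ ≤ C := le_max_left _ _
    have := hpow (p := -α) (q := -α) (by linarith) le_rfl
    calc _ ≤ C₁ * ((n : ℝ) + 1) ^ (-α) := hC₁ n x hx h
      _ ≤ C * (n : ℝ) ^ (-α) := by gcongr
  · have hxd : d ≤ |x - ξ| := by
      refine (min_le_right _ _).trans ?_
      rcases h with h | h
      · rw [abs_lt] at h
        exact le_trans (by linarith) (le_abs_self _)
      · rw [abs_lt] at h
        exact le_trans (by linarith) (neg_le_abs _)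
    have h1 := haway (K' := 1) le_rfl zero_le_one hxd
      (fun j => by simpa using abs_legendrePoly_eval_le_one j hx)
    rw [sub_zero] at h1
    refine h1.trans ?_
    gcongr
    exact (le_max_left _ _).trans (le_max_right _ _)
  · obtain ⟨hxξ, h1, h2⟩ := h
    -- Both factors of `(1 - x)(1 + x)` are at least `ε`, which explains the choice of `K`.
    have hx2 : ε ^ 2 ≤ 1 - x ^ 2 := by
      rw [abs_of_nonpos (by linarith [hx.2])] at h1
      rw [abs_of_nonneg (by linarith [hx.1])] at h2
      nlinarith
    have h3 := haway (K' := K) (σ := 1 / 2) (by norm_num) (by norm_num)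
      ((min_le_left _ _).trans hxξ)
      (fun j => abs_legendrePoly_eval_le_of_le j (by positivity) hx2)
    rw [show -α - 1 / 2 - 1 / 2 = -α - 1 by ring] at h3
    refine h3.trans ?_
    gcongr
    exact (le_max_right _ _).trans (le_max_right _ _)
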